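/- Theorem 1. An election consists of a finite directed graph $G=(N,E)$ on a set $N$ of voters, a voting cost $v(i)\in\mathbb{N}$ and a delegating cost $d(i)\in\mathbb{N}$ for every voter $i$ (costs may be $0$). A solution is a pair $(C,D)$ where $C\subseteq N$ is a set of casting voters and $D\subseteq E$ consists of exactly one outgoing edge for each voter in $N\setminus C$. It satisfies the reachability constraint if every voter $i\notin C$ has a directed path to a voter in $C$ using only edges of $D$, and its cost is $\sum_{i\in C}v(i)+\sum_{i\notin C}d(i)$. (a) Delegate Reachability is solvable in polynomial time: given an election and an integer budget $\beta\ge 1$, it can be decided by a (multi-stack) Turing machine, in a number of steps polynomial in the length of the input string (adjacency matrix of $G$; costs and budget written in binary), whether there is a solution of cost at most $\beta$ that satisfies the reachability constraint. (b) The greedy choice is optimal. Call a set $C\subseteq N$ greedy if it consists of all voters $i$ with $v(i)<d(i)$ and, for each sink component $S$ (a strongly connected component of $G$ that no edge leaves) containing no such voter, exactly one voter $i\in S$ that minimizes $v(i)+\sum_{j\in S\setminus\{i\}}d(j)$ over $S$, and of no other voters. Every election has a greedy set; and for every greedy set $C$ there is a $D$ such that $(C,D)$ is a solution satisfying the reachability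 constraint, and its cost is at most the cost of every solution satisfying the reachability constraint. -/

import Mathlib

/-! ### Elections with voting and delegating costs -/

/-- A liquid democracy election under costs: a finite directed graph on the voters `Fin n`, where
`(i, j) ∈ edges` says that `i` approves `j` as immediate representative, together with a voting
cost and a delegating cost for every voter. -/
structure CLDElection where
  n : ℕ
  edges : Finset (Fin n × Fin n)
  votingCost : Fin n → ℕ
  delegatingCost : Fin n → ℕ

namespace CLDElection

variable (I : CLDElection)

/-- `(C, D)` is a solution: `C` is the set of casting voters and `D` consists of exactly one
outgoing edge of the graph for every voter outside `C`. -/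
structure IsSolution (C : Finset (Fin I.n)) (D : Finset (Fin I.n × Fin I.n)) : Prop where
  subset_edges : D ⊆ I.edges
  source_notMem : ∀ e ∈ D, e.1 ∉ C
  existsUnique_edge : ∀ i, i ∉ C → ∃! j, (i, j) ∈ D

/-- The total cost of a solution whose set of casting voters is `C`. -/
def cost (C : Finset (Fin I.n)) : ℕ :=
  ∑ i ∈ C, I.votingCost i + ∑ i ∈ Cᶜ, I.delegatingCost i

/-- The reachability constraint: every delegating voter has a directed path to a casting voter
that uses only edges of `D`. -/
def ReachesCasters (C : Finset (Fin I.n)) (D : Finset (Fin I.n × Fin I.n)) : Prop :=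
  ∀ i, i ∉ C → ∃ c ∈ C, Relation.ReflTransGen (fun a b => (a, b) ∈ D) i c

/-! ### Strongly connected components and the greedy choice of casting voters -/

/-- There is a directed path (possibly of length zero) from `i` to `j` in the graph. -/
def Reaches (i j : Fin I.n) : Prop :=
  Relation.ReflTransGen (fun a b => (a, b) ∈ I.edges) i j

open Classical in
/-- The (maximal) strongly connected component of the voter `i`. -/
noncomputable def component (i : Fin I.n) : Finset (Fin I.n) :=
  Finset.univ.filter fun j => I.Reaches i j ∧ I.Reaches j i

/-- `S` is a strongly connected component that no edge of the graph leaves, that is, a sink of the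
decomposition of the graph into strongly connected components. -/
def IsSinkComponent (S : Finset (Fin I.n)) : Prop :=
  (∃ i, S = I.component i) ∧ ∀ e ∈ I.edges, e.1 ∈ S → e.2 ∈ S

/-- The voter `i` prefers casting a ballot to delegating. -/
def PrefersCasting (i : Fin I.n) : Prop :=
  I.votingCost i < I.delegatingCost i

/-- The cost incurred inside `S` if `i` is the only casting voter in `S`. -/
def soleCasterCost (S : Finset (Fin I.n)) (i : Fin I.n) : ℕ :=
  I.votingCost i + ∑ j ∈ S.erase i, I.delegatingCost j

/-- `C` is a possible outcome of the greedy choice: all voters who prefer casting cast, every sink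
component without such a voter gets exactly one casting voter, a cheapest one, and nobody else
casts. -/
structure IsGreedy (C : Finset (Fin I.n)) : Prop where
  prefersCasting_mem : ∀ i, I.PrefersCasting i → i ∈ C
  sink : ∀ S, I.IsSinkComponent S → (∀ i ∈ S, ¬ I.PrefersCasting i) →
    ∃ i ∈ S, C ∩ S = {i} ∧ ∀ j ∈ S, I.soleCasterCost S i ≤ I.soleCasterCost S j
  mem_only : ∀ i ∈ C, I.PrefersCasting i ∨
    ∃ S, I.IsSinkComponent S ∧ i ∈ S ∧ ∀ j ∈ S, ¬ I.PrefersCasting j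

end CLDElection

/-! ### The decision problem -/

/-- An instance of Delegate Reachability: an election and a positive integer budget. -/
structure DelegateReachabilityInstance where
  election : CLDElection
  budget : ℕ+

namespace DelegateReachabilityInstance

open Computability (Γ')

/-- The instance has a solution that satisfies the cost and the reachability constraint. -/
def IsYes (P : DelegateReachabilityInstance) : Prop :=
  ∃ (C : Finset (Fin P.election.n)) (D : Finset (Fin P.election.n × Fin P.election.n)),
    P.election.IsSolution C D ∧ P.election.cost C ≤ P.budget ∧ P.election.ReachesCasters C D

/-- A natural number in binary, over the Turing machine alphabet `Γ'`. -/
def encodeNumber (m : ℕ) : List Γ' :=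
  Computability.encodingNatΓ'.encode m

/-- The record of a voter `i`: the voting cost and the delegating cost in binary, and the row of
`i` in the adjacency matrix of the graph, as `[cost,cost,row]`. -/
def encodeVoter (I : CLDElection) (i : Fin I.n) : List Γ' :=
  [Γ'.bra] ++ encodeNumber (I.votingCost i) ++ [Γ'.comma] ++
    encodeNumber (I.delegatingCost i) ++ [Γ'.comma] ++
    (List.finRange I.n).map (fun j => Γ'.bit (decide ((i, j) ∈ I.edges))) ++ [Γ'.ket]

/-- The input string of an instance: the records of all voters, then the budget in binary. -/
def encode (P : DelegateReachabilityInstance) : List Γ' :=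
  (List.finRange P.election.n).flatMap (encodeVoter P.election) ++ encodeNumber P.budget

end DelegateReachabilityInstance

/-- A decision problem `P` on objects that are presented to the machine as strings by `enc` is
solvable in polynomial time: some multi-stack Turing machine answers every instance correctly
within a number of steps that is polynomial in the length of the input string. -/
def SolvableInPolyTime {α Γ : Type} (enc : α → List Γ) (P : α → Prop) : Prop :=
  ∃ f : α → Bool, (∀ a, f a = true ↔ P a) ∧
    Nonempty (Turing.TM2ComputableInPolyTime enc Computability.encodeBool f)

/-! ### Structured programs for multi-stack machines -/

namespace StackProgram

open Turing

/-! Optimality. Feasibility depends on `C` alone: if every voter reaches a caster in the graph, then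
delegating along edges that decrease the distance to `C` gives a suitable `D`
(`exists_solution_of_reaches`). Paths cannot leave a sink component, so a feasible `C` meets all of
them; conversely every voter reaches some sink component (`exists_reaches_sink`). The cost splits
over the strongly connected components. In a sink component where nobody prefers casting, at least
one caster is forced and all others are cheapest as delegators, so the cost there is at least the
least `soleCasterCost`. In every other component a greedy set lets each voter pay the smaller of the
two costs (`IsGreedy.sum_component_le`).

Complexity. It remains to compare the cost of one greedy set with the budget (`isYes_iff`). In
`greedySet`, membership of `i` is a test over pairs: `i` prefers casting, or every other voter
reachable from `i` reaches back, does not prefer casting, and is not a better caster by `extraCost`,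
ties going to the smaller index. So reachability, bitwise subtraction and pairwise comparison
suffice; components are never listed.

The machine arises by two translations. A `Cmd` has loops over `0, ..., N - 1` and an `N` by `N`
memory of finite cells, where `N` is one more than the input length. It becomes a `Prog` on stacks:
two stacks form a tape holding the memory, and each index is a pair of unary counters with sum `N`
(`does_compile`). A `Prog` becomes machine code with one label per instruction or test
(`Exec.iterate_step`). Loops are bounded and their nesting is fixed, so the running time is
polynomial. Numbers do not fit into the finite register, so all arithmetic is bit-serial, one digit
per column. `ok_decisionProgram` joins the stages. -/

/-- A single stack instruction over stacks `Γ` and internal states `σ`. -/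
inductive Instr {K : Type} (Γ : K → Type) (σ : Type)
  | push (k : K) (f : σ → Γ k)
  | pop (k : K) (f : σ → Option (Γ k) → σ)
  | peek (k : K) (f : σ → Option (Γ k) → σ)
  | load (f : σ → σ)

/-- Structured programs over stack instructions. -/
inductive Prog {K : Type} (Γ : K → Type) (σ : Type)
  | instr (i : Instr Γ σ)
  | seq (p q : Prog Γ σ)
  | ite (b : σ → Bool) (p q : Prog Γ σ)
  | loop (b : σ → Bool) (p : Prog Γ σ)

variable {K : Type} {Γ : K → Type} {σ Λ : Type}

namespace Instr

/-- The effect of an instruction on the internal state and the stacks. -/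
def apply [DecidableEq K] : Instr Γ σ → σ × (∀ k, List (Γ k)) → σ × (∀ k, List (Γ k))
  | push k f, (v, S) => (v, Function.update S k (f v :: S k))
  | pop k f, (v, S) => (f v (S k).head?, Function.update S k (S k).tail)
  | peek k f, (v, S) => (f v (S k).head?, S)
  | load f, (v, S) => (f v, S)

/-- The machine statement that executes an instruction before a statement. -/
def stmt : Instr Γ σ → TM2.Stmt Γ Λ σ → TM2.Stmt Γ Λ σ
  | push k f, q => .push k f q
  | pop k f, q => .pop k f q
  | peek k f, q => .peek k f q
  | load f, q => .load f q

theorem stepAux_stmt [DecidableEq K] (i : Instr Γ σ) (q : TM2.Stmt Γ Λ σ)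
    (c : σ × (∀ k, List (Γ k))) :
    TM2.stepAux (i.stmt q) c.1 c.2 = TM2.stepAux q (i.apply c).1 (i.apply c).2 := by
  cases i <;> rfl

end Instr

namespace Prog

/-- The control points of a program. -/
def Label : Prog Γ σ → Type
  | instr _ => Unit
  | seq p q => p.Label ⊕ q.Label
  | ite _ p q => Option (p.Label ⊕ q.Label)
  | loop _ p => Option p.Label

/-- There are finitely many control points. -/
@[reducible] def labelFintype : (p : Prog Γ σ) → Fintype p.Label
  | instr _ => inferInstanceAs (Fintype Unit)
  | seq p q =>
    let _ := p.labelFintype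
    let _ := q.labelFintype
    inferInstanceAs (Fintype (p.Label ⊕ q.Label))
  | ite _ p q =>
    let _ := p.labelFintype
    let _ := q.labelFintype
    inferInstanceAs (Fintype (Option (p.Label ⊕ q.Label)))
  | loop _ p =>
    let _ := p.labelFintype
    inferInstanceAs (Fintype (Option p.Label))

/-- The control point at which a program starts. -/
def entry : (p : Prog Γ σ) → p.Label
  | instr _ => ()
  | seq p _ => Sum.inl p.entry
  | ite _ _ _ => none
  | loop _ _ => none

/-- The machine code of a program inside a machine with labels `Λ`, for an embedding `emb` of the
control points and an `exit` label. -/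
def code : (p : Prog Γ σ) → (p.Label → Λ) → Λ → p.Label → TM2.Stmt Γ Λ σ
  | instr i, _, exit, _ => i.stmt (.goto fun _ => exit)
  | seq p q, emb, _, Sum.inl l =>
    p.code (fun l => emb (Sum.inl l)) (emb (Sum.inr q.entry)) l
  | seq _ q, emb, exit, Sum.inr l => q.code (fun l => emb (Sum.inr l)) exit l
  | ite b p q, emb, _, none =>
    .branch b (.goto fun _ => emb (some (Sum.inl p.entry)))
      (.goto fun _ => emb (some (Sum.inr q.entry)))
  | ite _ p _, emb, exit, some (Sum.inl l) => p.code (fun l => emb (some (Sum.inl l))) exit l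
  | ite _ _ q, emb, exit, some (Sum.inr l) => q.code (fun l => emb (some (Sum.inr l))) exit l
  | loop b p, emb, exit, none =>
    .branch b (.goto fun _ => emb (some p.entry)) (.goto fun _ => exit)
  | loop _ p, emb, _, some l => p.code (fun l => emb (some l)) (emb none) l

/-- `Exec p c t c'`: the program `p`, started in `c`, ends in `c'` after `t` steps. -/
inductive Exec [DecidableEq K] :
    Prog Γ σ → σ × (∀ k, List (Γ k)) → ℕ → σ × (∀ k, List (Γ k)) → Prop
  | instr (i c) : Exec (instr i) c 1 (i.apply c)
  | seq {p q c c' c'' t t'} : Exec p c t c' → Exec q c' t' c'' → Exec (seq p q) c (t + t') c''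
  | iteTrue {b p q c c' t} : b c.1 = true → Exec p c t c' → Exec (ite b p q) c (1 + t) c'
  | iteFalse {b p q c c' t} : b c.1 = false → Exec q c t c' → Exec (ite b p q) c (1 + t) c'
  | loopFalse {b p c} : b c.1 = false → Exec (loop b p) c 1 c
  | loopTrue {b p c c' c'' t t'} : b c.1 = true → Exec p c t c' → Exec (loop b p) c' t' c'' →
      Exec (loop b p) c (1 + t + t') c''

theorem Exec.instr_seq_instr [DecidableEq K] {i j : Instr Γ σ} {c c' : σ × (∀ k, List (Γ k))}
    (h : j.apply (i.apply c) = c') : Exec (.seq (.instr i) (.instr j)) c 2 c' :=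
  h ▸ .seq (.instr i c) (.instr j _)

/-- Induction on the execution. The exit label stays general because the first half of a sequence
exits to the entry of the second, and a loop body exits to the loop header. Instructions and tests
cost one machine step each; sequencing is free. -/
theorem Exec.iterate_step [DecidableEq K] {p : Prog Γ σ} {c c' : σ × (∀ k, List (Γ k))} {t : ℕ}
    (h : Exec p c t c') {M : Λ → TM2.Stmt Γ Λ σ} (emb : p.Label → Λ) (exit : Λ)
    (hM : ∀ l, M (emb l) = p.code emb exit l) :
    (flip bind (TM2.step M))^[t] (some ⟨some (emb p.entry), c.1, c.2⟩) =
      some ⟨some exit, c'.1, c'.2⟩ := by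
  induction h generalizing exit with
  | instr i c =>
    have := hM ()
    simp only [code] at this
    simp [flip, entry, this, Instr.stepAux_stmt]
  | @seq p q c c' c'' t t' _ _ ih₁ ih₂ =>
    rw [Nat.add_comm, Function.iterate_add_apply]
    have h₁ := ih₁ (fun l => emb (Sum.inl l)) (emb (Sum.inr q.entry)) (fun l => hM _)
    have h₂ := ih₂ (fun l => emb (Sum.inr l)) exit (fun l => hM _)
    rw [← h₂, ← h₁]
    rfl
  | @iteTrue b p q c c' t hb _ ih =>
    rw [Nat.add_comm, Function.iterate_add_apply]
    rw [← ih (fun l => emb (some (Sum.inl l))) exit (fun l => hM _)]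
    have := hM none
    simp only [code] at this
    simp [flip, entry, this, hb]
  | @iteFalse b p q c c' t hb _ ih =>
    rw [Nat.add_comm, Function.iterate_add_apply]
    rw [← ih (fun l => emb (some (Sum.inr l))) exit (fun l => hM _)]
    have := hM none
    simp only [code] at this
    simp [flip, entry, this, hb]
  | @loopFalse b p c hb =>
    have := hM none
    simp only [code] at this
    simp [flip, entry, this, hb]
  | @loopTrue b p c c' c'' t t' hb _ _ ih₁ ih₂ =>
    rw [Nat.add_comm, Function.iterate_add_apply, Nat.add_comm 1 t, Function.iterate_add_apply]
    rw [← ih₂ emb exit hM]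
    congr 1
    have h₁ := ih₁ (fun l => emb (some l)) (emb none) (fun l => hM _)
    refine Eq.trans ?_ h₁
    congr 1
    have := hM none
    simp only [code] at this
    simp [flip, entry, this, hb]

end Prog

end StackProgram

/-! ### Counters and a cell memory on stacks -/

namespace StackProgram

open Turing

/-- The counters of the machine: a temporary one, and for every index `c` the value of `c` and its
distance to the common upper bound. -/
inductive Counter (C : Type)
  | tmp
  | val (c : C)
  | rest (c : C)
  deriving DecidableEq, Fintype

/-- The stacks of the machine: two for input symbols, two for memory cells, one for every counter
and one for the output. -/
inductive Stack (C : Type)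
  | sym (b : Bool)
  | cell (b : Bool)
  | cnt (n : Counter C)
  | out
  deriving DecidableEq, Fintype

/-- The alphabets of the stacks. -/
@[reducible] def Alphabet (Sym Cell C : Type) : Stack C → Type
  | .sym _ => Sym
  | .cell _ => Cell
  | .cnt _ => Unit
  | .out => Bool

/-- The internal state of the machine: a register and buffers for one bit, one input symbol and one
memory cell. -/
@[ext] structure Local (Sym Cell Reg : Type) where
  reg : Reg
  flag : Bool
  sym : Sym
  cell : Cell

noncomputable instance {Sym Cell Reg : Type} [Fintype Sym] [Fintype Cell] [Fintype Reg] :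
    Fintype (Local Sym Cell Reg) :=
  Fintype.ofInjective (fun v => (v.reg, v.flag, v.sym, v.cell)) fun v v' h => by
    simpa [Local.ext_iff] using h

/-- The contents of the stacks and of the register. -/
@[ext] structure Store (Sym Cell C Reg : Type) where
  reg : Reg
  sym : Bool → List Sym
  cell : Bool → List Cell
  cnt : Counter C → ℕ
  out : List Bool

variable {Sym Cell C Reg : Type}

namespace Store

/-- The stacks that hold the contents of a store. -/
def stk (s : Store Sym Cell C Reg) : ∀ k : Stack C, List (Alphabet Sym Cell C k)
  | .sym b => s.sym b
  | .cell b => s.cell b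
  | .cnt n => List.replicate (s.cnt n) ()
  | .out => s.out

variable [DecidableEq C]

theorem update_stk_sym (s : Store Sym Cell C Reg) (b : Bool) (l : List Sym) :
    Function.update s.stk (.sym b) l = ({ s with sym := Function.update s.sym b l }).stk := by
  funext k
  cases k with
  | sym b' => by_cases h : b' = b
              · subst h; simp [stk]
              · simp [stk, h]
  | _ => simp [stk]

theorem update_stk_cell (s : Store Sym Cell C Reg) (b : Bool) (l : List Cell) :
    Function.update s.stk (.cell b) l = ({ s with cell := Function.update s.cell b l }).stk := by
  funext k
  cases k with
  | cell b' => by_cases h : b' = b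
               · subst h; simp [stk]
               · simp [stk, h]
  | _ => simp [stk]

theorem update_stk_cnt (s : Store Sym Cell C Reg) (n : Counter C) (m : ℕ) :
    Function.update s.stk (.cnt n) (List.replicate m ()) =
      ({ s with cnt := Function.update s.cnt n m }).stk := by
  funext k
  cases k with
  | cnt n' => by_cases h : n' = n
              · subst h; simp [stk]
              · simp [stk, h]
  | _ => simp [stk]

theorem update_stk_out (s : Store Sym Cell C Reg) (l : List Bool) :
    Function.update s.stk .out l = ({ s with out := l }).stk := by
  funext k
  cases k <;> simp [stk]

end Store

/-- The programs over the stacks of the machine. -/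
abbrev MProg (Sym Cell C Reg : Type) := Prog (Alphabet Sym Cell C) (Local Sym Cell Reg)

variable [DecidableEq C]

/-- `Does p T s s'`: the program `p` turns the store `s` into `s'` within `T` steps. -/
def Does (p : MProg Sym Cell C Reg) (T : ℕ) (s s' : Store Sym Cell C Reg) : Prop :=
  ∀ v : Local Sym Cell Reg, v.reg = s.reg → ∃ t ≤ T, ∃ v' : Local Sym Cell Reg, v'.reg = s'.reg ∧
    Prog.Exec p (v, s.stk) t (v', s'.stk)

namespace Does

variable {p q : MProg Sym Cell C Reg} {T T' : ℕ} {s s' s'' : Store Sym Cell C Reg}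

theorem mono (h : Does p T s s') (hT : T ≤ T') : Does p T' s s' := fun v hv =>
  let ⟨t, ht, r⟩ := h v hv
  ⟨t, ht.trans hT, r⟩

theorem congr_right (h : Does p T s s') (hs : s' = s'') : Does p T s s'' :=
  hs ▸ h

theorem seq (h : Does p T s s') (h' : Does q T' s' s'') : Does (.seq p q) (T + T') s s'' := by
  intro v hv
  obtain ⟨t, ht, v', hv', e⟩ := h v hv
  obtain ⟨t', ht', v'', hv'', e'⟩ := h' v' hv'
  exact ⟨t + t', by lia, v'', hv'', e.seq e'⟩

theorem ite {b : Reg → Bool} (h : b s.reg = true → Does p T s s')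
    (h' : b s.reg = false → Does q T s s') :
    Does (.ite (fun v => b v.reg) p q) (1 + T) s s' := by
  intro v hv
  cases hb : b s.reg
  · obtain ⟨t, ht, v', hv', e⟩ := h' hb v hv
    exact ⟨1 + t, by lia, v', hv', .iteFalse (by simpa [hv] using hb) e⟩
  · obtain ⟨t, ht, v', hv', e⟩ := h hb v hv
    exact ⟨1 + t, by lia, v', hv', .iteTrue (by simpa [hv] using hb) e⟩

theorem instr {i : Instr (Alphabet Sym Cell C) (Local Sym Cell Reg)}
    (h : ∀ v, v.reg = s.reg → (i.apply (v, s.stk)).1.reg = s'.reg)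
    (h' : ∀ v, v.reg = s.reg → (i.apply (v, s.stk)).2 = s'.stk) : Does (.instr i) 1 s s' := by
  intro v hv
  refine ⟨1, le_rfl, (i.apply (v, s.stk)).1, h v hv, ?_⟩
  rw [← h' v hv]
  exact .instr i _

end Does

theorem does_skip (s : Store Sym Cell C Reg) : Does (.instr (.load id)) 1 s s :=
  .instr (fun _ hv => hv) fun _ _ => rfl

/-- Store in the flag whether the stack `k` is nonempty. -/
def test (k : Stack C) : MProg Sym Cell C Reg :=
  .instr (.peek k fun v x => { v with flag := x.isSome })

/-- Repeat a program as long as the stack `k` is nonempty. -/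
def whileNonempty (k : Stack C) (p : MProg Sym Cell C Reg) : MProg Sym Cell C Reg :=
  .seq (test k) (.loop (fun v => v.flag) (.seq p (test k)))

/-- The flag that steers the loop is left unspecified by `Does`, so the induction runs over
executions and carries the flag along. A pass costs `T` plus the branch and the renewed test; the
final `2` is the first test and the failing branch. -/
theorem Does.whileNonempty {k : Stack C} {p : MProg Sym Cell C Reg} {T n : ℕ}
    (f : ℕ → Store Sym Cell C Reg) (hp : ∀ i < n, Does p T (f i) (f (i + 1)))
    (hne : ∀ i < n, (f i).stk k ≠ []) (he : (f n).stk k = []) :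
    Does (whileNonempty k p) (n * (T + 2) + 2) (f 0) (f n) := by
  have key : ∀ m i, i + m = n → ∀ v : Local Sym Cell Reg, v.reg = (f i).reg →
      v.flag = ((f i).stk k).head?.isSome → ∃ t ≤ m * (T + 2) + 1, ∃ v' : Local Sym Cell Reg,
        v'.reg = (f n).reg ∧ Prog.Exec (.loop (fun v => v.flag) (.seq p (test k)))
          (v, (f i).stk) t (v', (f n).stk) := by
    intro m
    induction m with
    | zero =>
      intro i hi v hv hf
      obtain rfl : i = n := by lia
      exact ⟨1, by lia, v, hv, .loopFalse (by simp [hf, he])⟩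
    | succ m ih =>
      intro i hi v hv hf
      obtain ⟨t, ht, v', hv', e⟩ := hp i (by lia) v hv
      obtain ⟨t', ht', v'', hv'', e'⟩ := ih (i + 1) (by lia)
        { v' with flag := ((f (i + 1)).stk k).head?.isSome } hv' rfl
      refine ⟨1 + (t + 1) + t', by lia, v'', hv'', .loopTrue ?_ (.seq e (.instr _ _)) e'⟩
      have := hne i (by lia)
      simp [hf, List.head?_eq_none_iff, Option.isSome_iff_ne_none, this]
  intro v hv
  obtain ⟨t, ht, v', hv', e⟩ := key n 0 (by lia)
    { v with flag := ((f 0).stk k).head?.isSome } hv rfl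
  exact ⟨1 + t, by lia, v', hv', .seq (.instr _ _) e⟩

theorem does_iteNonempty {k : Stack C} {p q : MProg Sym Cell C Reg} {T : ℕ}
    {s s' : Store Sym Cell C Reg} (h : s.stk k ≠ [] → Does p T s s')
    (h' : s.stk k = [] → Does q T s s') :
    Does (.seq (test k) (.ite (fun v => v.flag) p q)) (2 + T) s s' := by
  intro v hv
  by_cases hk : s.stk k = []
  · obtain ⟨t, ht, v', hv', e⟩ := h' hk { v with flag := (s.stk k).head?.isSome } hv
    exact ⟨1 + (1 + t), by lia, v', hv', .seq (.instr _ _)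
      (.iteFalse (c := ({ v with flag := (s.stk k).head?.isSome }, s.stk)) (by simp [hk]) e)⟩
  · obtain ⟨t, ht, v', hv', e⟩ := h hk { v with flag := (s.stk k).head?.isSome } hv
    exact ⟨1 + (1 + t), by lia, v', hv', .seq (.instr _ _)
      (.iteTrue (c := ({ v with flag := (s.stk k).head?.isSome }, s.stk))
        (by simp [Option.isSome_iff_ne_none, hk]) e)⟩

/-! ### Counters -/

/-- Decrement the counter `a`, if possible, and increment the counter `b`. -/
def moveUnit (a b : Counter C) : MProg Sym Cell C Reg :=
  .seq (.instr (.pop (.cnt a) fun v _ => v)) (.instr (.push (.cnt b) fun _ => ()))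

/-- Increment a counter. -/
def pushUnit (a : Counter C) : MProg Sym Cell C Reg :=
  .instr (.push (.cnt a) fun _ => ())

/-- Add the counter `a` to the counter `b` and clear `a`. -/
def drain (a b : Counter C) : MProg Sym Cell C Reg :=
  whileNonempty (.cnt a) (moveUnit a b)

namespace Store

/-- Change the counters `a` and `b`. -/
def setCnt (s : Store Sym Cell C Reg) (a b : Counter C) (m n : ℕ) : Store Sym Cell C Reg :=
  { s with cnt := Function.update (Function.update s.cnt a m) b n }

end Store

theorem does_pushUnit (a : Counter C) (s : Store Sym Cell C Reg) :
    Does (pushUnit a) 1 s { s with cnt := Function.update s.cnt a (s.cnt a + 1) } := by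
  refine .instr (fun v hv => hv) fun v _ => ?_
  rw [← Store.update_stk_cnt, List.replicate_succ]
  rfl

theorem does_popUnit (a : Counter C) (s : Store Sym Cell C Reg) :
    Does (.instr (.pop (.cnt a) fun v _ => v)) 1 s
      { s with cnt := Function.update s.cnt a (s.cnt a - 1) } := by
  refine .instr (fun v hv => hv) fun v _ => ?_
  rw [← Store.update_stk_cnt, ← List.tail_replicate]
  rfl

theorem does_moveUnit {a b : Counter C} (h : a ≠ b) (s : Store Sym Cell C Reg) :
    Does (moveUnit a b) 2 s (s.setCnt a b (s.cnt a - 1) (s.cnt b + 1)) := by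
  have : Does (moveUnit a b) 2 s _ := (does_popUnit a s).seq (does_pushUnit b _)
  simpa only [Store.setCnt, Function.update_of_ne h.symm] using this

theorem does_drain {a b : Counter C} (h : a ≠ b) (s : Store Sym Cell C Reg) :
    Does (drain a b) (s.cnt a * 4 + 2) s (s.setCnt a b 0 (s.cnt b + s.cnt a)) := by
  have key := Does.whileNonempty (k := .cnt a) (p := moveUnit a b) (T := 2) (n := s.cnt a)
    (fun i => s.setCnt a b (s.cnt a - i) (s.cnt b + i)) ?_ ?_ ?_
  · simpa [Store.setCnt, Function.update_of_ne h.symm, drain] using key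
  · intro i hi
    convert does_moveUnit h _ using 1
    simp only [Store.setCnt, Function.update_self, Function.update_of_ne h, Store.mk.injEq,
      true_and, and_true]
    funext n
    by_cases hb : n = b
    · subst hb; simp; lia
    · by_cases ha : n = a
      · subst ha; simp [hb]; lia
      · simp [ha, hb]
  · intro i hi
    simp [Store.stk, Store.setCnt, Function.update_of_ne h]
    lia
  · simp [Store.stk, Store.setCnt, Function.update_of_ne h]

end StackProgram

/-! ### Random access to the cell memory -/

namespace StackProgram

open Turing

variable {Sym Cell C Reg : Type} [DecidableEq C]

namespace Store

/-- A counter that drives a loop is emptied into a second one and poured back afterwards; this gives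
the net effect, and `setCnt_eq_self` then recovers the original store. -/
theorem setCnt_swap (s : Store Sym Cell C Reg) {a b : Counter C} (h : a ≠ b) (m n m' n' : ℕ) :
    (s.setCnt a b m n).setCnt b a m' n' = s.setCnt a b n' m' := by
  simp only [setCnt, mk.injEq, true_and, and_true]
  funext k
  by_cases hb : k = b
  · subst hb; simp [h.symm]
  · by_cases ha : k = a
    · subst ha; simp [hb]
    · simp [ha, hb]

theorem setCnt_comm (s : Store Sym Cell C Reg) {a b : Counter C} (h : a ≠ b) (m n : ℕ) :
    s.setCnt a b m n = s.setCnt b a n m := by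
  simp only [setCnt, Function.update_comm h]

theorem setCnt_setCnt (s : Store Sym Cell C Reg) {a b : Counter C} (h : a ≠ b) (m n m' n' : ℕ) :
    (s.setCnt a b m n).setCnt a b m' n' = s.setCnt a b m' n' := by
  simp only [setCnt, mk.injEq, true_and, and_true]
  funext k
  by_cases hb : k = b
  · subst hb; simp
  · by_cases ha : k = a
    · subst ha; simp [hb]
    · simp [ha, hb]

theorem setCnt_eq_self {s : Store Sym Cell C Reg} {a b : Counter C} {m n : ℕ}
    (ha : s.cnt a = m) (hb : s.cnt b = n) : s.setCnt a b m n = s := by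
  subst ha hb
  simp [setCnt]

/-- The store in which the cell memory has contents `l` and is being read at position `p`. -/
def atPos (s : Store Sym Cell C Reg) (l : List Cell) (p : ℕ) : Store Sym Cell C Reg :=
  { s with cell := fun b => if b then (l.take p).reverse else l.drop p }

end Store

/-- Move a cell from the stack `cell b` to the other stack of cells. -/
def moveCell (b : Bool) : MProg Sym Cell C Reg :=
  .seq (.instr (.pop (.cell b) fun v x => { v with cell := x.getD v.cell }))
    (.instr (.push (.cell !b) fun v => v.cell))

theorem does_moveCell (s : Store Sym Cell C Reg) (b : Bool) (x : Cell) (l : List Cell)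
    (h : s.cell b = x :: l) :
    Does (moveCell b) 2 s { s with cell := fun b' => if b' = b then l else x :: s.cell b' } := by
  intro v hv
  refine ⟨2, le_rfl, { v with cell := x }, hv, .instr_seq_instr ?_⟩
  have h' : s.stk (.cell b) = x :: l := h
  simp only [Instr.apply, h', List.head?_cons, List.tail_cons, Option.getD_some, Prod.mk.injEq,
    true_and]
  rw [Store.update_stk_cell, Store.update_stk_cell]
  congr 2
  funext b'
  cases b <;> cases b' <;> simp [Store.stk]

theorem does_moveCell_forward (s : Store Sym Cell C Reg) (l : List Cell) (p : ℕ)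
    (h : p < l.length) : Does (moveCell false) 2 (s.atPos l p) (s.atPos l (p + 1)) := by
  convert does_moveCell (s.atPos l p) false l[p] (l.drop (p + 1)) (by simp [Store.atPos]) using 1
  simp only [Store.atPos, Store.mk.injEq, true_and, and_true]
  funext b
  cases b
  · simp
  · simp only [if_true, List.take_succ_eq_append_getElem h, List.reverse_append,
      List.reverse_singleton]
    rfl

theorem does_moveCell_backward (s : Store Sym Cell C Reg) (l : List Cell) (p : ℕ)
    (h : p < l.length) : Does (moveCell true) 2 (s.atPos l (p + 1)) (s.atPos l p) := by
  convert does_moveCell (s.atPos l (p + 1)) true l[p] (l.take p).reverse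
    (by simp only [Store.atPos, if_true, List.take_succ_eq_append_getElem h, List.reverse_append,
          List.reverse_singleton]
        rfl) using 1
  simp only [Store.atPos, Store.mk.injEq, true_and, and_true]
  funext b
  cases b <;> simp

/-- Move back to the start of the cell memory. -/
def rewind : MProg Sym Cell C Reg :=
  whileNonempty (.cell true) (moveCell true)

theorem does_rewind (s : Store Sym Cell C Reg) (l : List Cell) (p : ℕ) (h : p ≤ l.length) :
    Does rewind (p * 4 + 2) (s.atPos l p) (s.atPos l 0) := by
  have key := Does.whileNonempty (k := .cell true) (p := moveCell (C := C) (Reg := Reg)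
    (Sym := Sym) (Cell := Cell) true) (T := 2) (n := p) (fun i => s.atPos l (p - i)) ?_ ?_ ?_
  · simpa [rewind] using key
  · intro i hi
    obtain ⟨j, hj⟩ : ∃ j, p - i = j + 1 := ⟨p - i - 1, by lia⟩
    rw [hj, show p - (i + 1) = j by lia]
    exact does_moveCell_backward s l j (by lia)
  · intro i hi
    have h1 : p - i ≠ 0 := by lia
    have h2 : l ≠ [] := by rintro rfl; simp at h; lia
    simp [Store.stk, Store.atPos, h1, h2]
  · simp [Store.stk, Store.atPos]

/-- Apply `h` to the register and the current cell. -/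
def modify (h : Reg → Cell → Reg × Cell) : MProg Sym Cell C Reg :=
  .seq (.instr (.pop (.cell false) fun v x =>
      { v with reg := (h v.reg (x.getD v.cell)).1, cell := (h v.reg (x.getD v.cell)).2 }))
    (.instr (.push (.cell false) fun v => v.cell))

theorem does_modify (h : Reg → Cell → Reg × Cell) (s : Store Sym Cell C Reg) (l : List Cell) (p : ℕ)
    (hp : p < l.length) :
    Does (modify h) 2 (s.atPos l p)
      ({ s with reg := (h s.reg l[p]).1 }.atPos (l.set p (h s.reg l[p]).2) p) := by
  intro v hv
  replace hv : v.reg = s.reg := hv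
  refine ⟨2, le_rfl, { v with reg := (h s.reg l[p]).1, cell := (h s.reg l[p]).2 }, rfl,
    .instr_seq_instr ?_⟩
  -- The stack is nonempty, so the fallback `v.cell` of `getD` is never used.
  have h' : (s.atPos l p).stk (.cell false) = l[p] :: l.drop (p + 1) := by
    simp [Store.stk, Store.atPos]
  simp only [Instr.apply, h', List.head?_cons, List.tail_cons, Option.getD_some, Prod.mk.injEq,
    hv, true_and]
  rw [Store.update_stk_cell, Store.update_stk_cell]
  funext k
  cases k with
  | cell b =>
    cases b
    · have hp' : p < (l.set p (h s.reg l[p]).2).length := by simpa using hp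
      simp only [Store.stk, Store.atPos, Function.update_self, Bool.false_eq_true, if_false,
        List.drop_eq_getElem_cons hp', List.getElem_set_self,
        List.drop_set_of_lt (Nat.lt_succ_self p)]
    · simp [Store.stk, Store.atPos, List.take_set_of_le]
  | _ => rfl

/-- Move forward in the cell memory by the upper bound of the counters, using the counter `w`. -/
def walkRow (w : C) : MProg Sym Cell C Reg :=
  .seq (whileNonempty (.cnt (.rest w)) (.seq (moveUnit (.rest w) (.val w)) (moveCell false)))
    (drain (.val w) (.rest w))

/-- The pair `rest w`, `val w` starts as `N`, `0`, so using up `rest w` takes exactly `N` cell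
moves; the drain restores the pair. -/
theorem does_walkRow {w : C} {N : ℕ} (s : Store Sym Cell C Reg) (l : List Cell) (p : ℕ)
    (hp : p + N ≤ l.length) (hr : s.cnt (.rest w) = N) (hv : s.cnt (.val w) = 0) :
    Does (walkRow w) (N * 10 + 4) (s.atPos l p) (s.atPos l (p + N)) := by
  have hne : Counter.rest w ≠ .val w := by simp
  have key := Does.whileNonempty (k := .cnt (.rest w)) (p := .seq (moveUnit (.rest w) (.val w))
    (moveCell (C := C) (Reg := Reg) (Sym := Sym) (Cell := Cell) false)) (T := 4) (n := N)
    (fun i => (s.setCnt (.rest w) (.val w) (N - i) i).atPos l (p + i)) ?_ ?_ ?_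
  · have := Does.mono (T' := N * 10 + 4) (Does.seq key (does_drain hne.symm _)) ?_
    · rw [show (s.setCnt (.rest w) (.val w) (N - 0) 0).atPos l (p + 0) = s.atPos l p by
        rw [Store.setCnt_eq_self (by simpa using hr) hv]; simp] at this
      unfold walkRow
      convert this using 1
      change _ =
        ((s.setCnt (.rest w) (.val w) (N - N) N).setCnt (.val w) (.rest w) _ _).atPos l (p + N)
      rw [Store.setCnt_swap _ hne]
      congr 1
      exact (Store.setCnt_eq_self (by simp [Store.atPos, Store.setCnt, hr])
        (by simp [hv])).symm
    · simp [Store.atPos, Store.setCnt]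
      lia
  · intro i hi
    refine Does.seq (T := 2) (T' := 2) (does_moveUnit hne _) ?_
    convert does_moveCell_forward (s.setCnt (.rest w) (.val w) (N - (i + 1)) (i + 1)) l (p + i)
      (by lia) using 1
    · change Store.atPos (Store.setCnt _ _ _ _ _) l (p + i) = _
      rw [Store.setCnt_setCnt _ hne]
      congr 2
      · simp [Store.atPos, Store.setCnt]; lia
      · simp [Store.atPos, Store.setCnt]
    · rfl
  · intro i hi
    simp [Store.stk, Store.atPos, Store.setCnt]
    lia
  · simp [Store.stk, Store.atPos, Store.setCnt]

/-- Apply `h` to the register and the cell in the row given by the counter `a` and the column given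
by the counter `b`; the counter `w` serves to skip rows. -/
def access (w a b : C) (h : Reg → Cell → Reg × Cell) : MProg Sym Cell C Reg :=
  .seq (whileNonempty (.cnt (.val a)) (.seq (moveUnit (.val a) .tmp) (walkRow w)))
  (.seq (drain .tmp (.val a))
  (.seq (whileNonempty (.cnt (.val b)) (.seq (moveUnit (.val b) .tmp) (moveCell false)))
  (.seq (drain .tmp (.val b))
  (.seq (modify h) rewind))))

/-- The square lies row by row in one list, so the head walks `A` rows and then `B` cells. The
counter driving each walk is parked in `tmp` and poured back. Row skipping needs `w` unchanged,
hence `a ≠ w`. -/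
theorem does_access {w a b : C} {N : ℕ} (h : Reg → Cell → Reg × Cell) (s : Store Sym Cell C Reg)
    (l : List Cell) (hl : l.length = N * N) (ha : a ≠ w)
    (hr : s.cnt (.rest w) = N) (hv : s.cnt (.val w) = 0) (ht : s.cnt .tmp = 0)
    (hA : s.cnt (.val a) < N)
    (hp : s.cnt (.val a) * N + s.cnt (.val b) < l.length) :
    Does (access w a b h) (14 * N * N + 26 * N + 12) (s.atPos l 0)
      ({ s with reg := (h s.reg l[s.cnt (.val a) * N + s.cnt (.val b)]).1 }.atPos
        (l.set (s.cnt (.val a) * N + s.cnt (.val b))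
          (h s.reg l[s.cnt (.val a) * N + s.cnt (.val b)]).2) 0) := by
  generalize hA' : s.cnt (.val a) = A at *
  generalize hB' : s.cnt (.val b) = B at *
  have key₁ : Does (whileNonempty (.cnt (.val a)) (.seq (moveUnit (.val a) .tmp) (walkRow w)))
      (A * (2 + (N * 10 + 4) + 2) + 2) (s.atPos l 0)
      ((s.setCnt (.val a) .tmp 0 A).atPos l (A * N)) := by
    have key := Does.whileNonempty (k := .cnt (.val a)) (p := .seq (moveUnit (.val a) .tmp)
      (walkRow (C := C) (Reg := Reg) (Sym := Sym) (Cell := Cell) w))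
      (T := 2 + (N * 10 + 4)) (n := A)
      (fun i => (s.setCnt (.val a) .tmp (A - i) i).atPos l (i * N)) ?_ ?_ ?_
    · convert key using 1
      · rw [Store.setCnt_eq_self (by simpa using hA') ht]; simp
      · simp
    · intro i hi
      refine Does.seq (does_moveUnit (by simp) _) ?_
      have hle : i * N + N ≤ l.length := by
        rw [hl, ← Nat.succ_mul]
        exact Nat.mul_le_mul_right N (by lia)
      convert does_walkRow (N := N) (w := w) (s.setCnt (.val a) .tmp (A - (i + 1)) (i + 1)) l
        (i * N) hle (by simp [Store.setCnt, hr]) (by simp [Store.setCnt, ha.symm, hv]) using 1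
      · change Store.atPos (Store.setCnt _ _ _ _ _) l (i * N) = _
        rw [Store.setCnt_setCnt _ (by simp)]
        congr 2
        · simp [Store.atPos, Store.setCnt]; lia
      · rw [Nat.succ_mul]
    · intro i hi
      simp [Store.stk, Store.atPos, Store.setCnt]
      lia
    · simp [Store.stk, Store.atPos, Store.setCnt]
  have key₂ : Does (drain .tmp (.val a)) (A * 4 + 2)
      ((s.setCnt (.val a) .tmp 0 A).atPos l (A * N)) (s.atPos l (A * N)) := by
    convert does_drain (show Counter.tmp ≠ .val a by simp) _ using 1
    · simp [Store.atPos, Store.setCnt]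
    · change _ = Store.atPos (Store.setCnt _ _ _ _ _) l (A * N)
      rw [Store.setCnt_swap _ (by simp)]
      congr 1
      exact (Store.setCnt_eq_self (by simp [Store.atPos, Store.setCnt, hA']) ht).symm
  have key₃ : Does (whileNonempty (.cnt (.val b)) (.seq (moveUnit (.val b) .tmp) (moveCell false)))
      (B * (2 + 2 + 2) + 2) (s.atPos l (A * N))
      ((s.setCnt (.val b) .tmp 0 B).atPos l (A * N + B)) := by
    have key := Does.whileNonempty (k := .cnt (.val b)) (p := .seq (moveUnit (.val b) .tmp)
      (moveCell (C := C) (Reg := Reg) (Sym := Sym) (Cell := Cell) false)) (T := 2 + 2) (n := B)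
      (fun i => (s.setCnt (.val b) .tmp (B - i) i).atPos l (A * N + i)) ?_ ?_ ?_
    · convert key using 1
      · rw [Store.setCnt_eq_self (by simpa using hB') ht]; simp
      · simp
    · intro i hi
      refine Does.seq (does_moveUnit (by simp) _) ?_
      convert does_moveCell_forward (s.setCnt (.val b) .tmp (B - (i + 1)) (i + 1)) l
        (A * N + i) (by lia) using 1
      · change Store.atPos (Store.setCnt _ _ _ _ _) l (A * N + i) = _
        rw [Store.setCnt_setCnt _ (by simp)]
        congr 2
        · simp [Store.atPos, Store.setCnt]; lia
      · rfl
    · intro i hi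
      simp [Store.stk, Store.atPos, Store.setCnt]
      lia
    · simp [Store.stk, Store.atPos, Store.setCnt]
  have key₄ : Does (drain .tmp (.val b)) (B * 4 + 2)
      ((s.setCnt (.val b) .tmp 0 B).atPos l (A * N + B)) (s.atPos l (A * N + B)) := by
    convert does_drain (show Counter.tmp ≠ .val b by simp) _ using 1
    · simp [Store.atPos, Store.setCnt]
    · change _ = Store.atPos (Store.setCnt _ _ _ _ _) l (A * N + B)
      rw [Store.setCnt_swap _ (by simp)]
      congr 1
      exact (Store.setCnt_eq_self (by simp [Store.atPos, Store.setCnt, hB']) ht).symm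
  refine (key₁.seq (key₂.seq (key₃.seq (key₄.seq ((does_modify h s l _ hp).seq
    (does_rewind _ _ _ (by simpa using hp.le))))))).mono ?_
  -- The walks and the rewinding cost at most `14 * (A * N + B) + 12 * A + 12`, so `B` needs no
  -- bound of its own beyond `hp`.
  have h1 : A * (2 + (N * 10 + 4) + 2) ≤ N * (2 + (N * 10 + 4) + 2) :=
    Nat.mul_le_mul_right _ hA.le
  rw [hl] at hp
  nlinarith

end StackProgram

/-! ### Programs with bounded loops and a square cell memory -/

namespace StackProgram

open Turing

/-- The state of a bounded program: a register, the unread input, the values of the index variables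
and the cell memory. -/
structure State (Sym Cell C Reg : Type) where
  reg : Reg
  inp : List Sym
  idx : C → ℕ
  mem : ℕ → ℕ → Cell

/-- Bounded programs: access to a cell, reading an input symbol, incrementing and clearing an index
variable, composition, branching, and loops over all values of an index variable. -/
inductive Cmd (Sym Cell C Reg : Type)
  | cell (a b : C) (h : Reg → Cell → Reg × Cell)
  | next (f : Reg → Option Sym → Reg)
  | inc (c : C)
  | zero (c : C)
  | seq (p q : Cmd Sym Cell C Reg)
  | ite (b : Reg → Bool) (p q : Cmd Sym Cell C Reg)
  | forEach (c : C) (p : Cmd Sym Cell C Reg)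

variable {Sym Cell C Reg : Type}

namespace Cmd

/-- A bound on the number of steps of the implementation. -/
def cost (N : ℕ) : Cmd Sym Cell C Reg → ℕ
  | cell _ _ _ => 14 * N * N + 26 * N + 12
  | next _ => 1
  | inc _ => 6
  | zero _ => N * 4 + 2
  | seq p q => p.cost N + q.cost N
  | ite _ p q => 1 + (p.cost N + q.cost N)
  | forEach _ p => (N * 4 + 2) + ((N * ((p.cost N + 2) + 2) + 2) + (N * 4 + 2))

/-- A loop multiplies the cost of its body by `N`, everything else adds, and the nesting is fixed by
the program. -/
theorem exists_polynomial_cost (p : Cmd Sym Cell C Reg) :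
    ∃ P : Polynomial ℕ, ∀ N, p.cost N = P.eval N := by
  induction p with
  | cell => exact ⟨14 * .X * .X + 26 * .X + 12, fun N => by simp [cost]⟩
  | next => exact ⟨1, fun N => by simp [cost]⟩
  | inc => exact ⟨6, fun N => by simp [cost]⟩
  | zero => exact ⟨.X * 4 + 2, fun N => by simp [cost]⟩
  | seq p q ihp ihq =>
    obtain ⟨P, hP⟩ := ihp
    obtain ⟨Q, hQ⟩ := ihq
    exact ⟨P + Q, fun N => by simp [cost, hP, hQ]⟩
  | ite b p q ihp ihq =>
    obtain ⟨P, hP⟩ := ihp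
    obtain ⟨Q, hQ⟩ := ihq
    exact ⟨1 + (P + Q), fun N => by simp [cost, hP, hQ]⟩
  | forEach c p ih =>
    obtain ⟨P, hP⟩ := ih
    exact ⟨(.X * 4 + 2) + ((.X * ((P + 2) + 2) + 2) + (.X * 4 + 2)), fun N => by simp [cost, hP]⟩

end Cmd

variable [DecidableEq C]

namespace State

/-- Set an index variable. -/
def setIdx (s : State Sym Cell C Reg) (c : C) (n : ℕ) : State Sym Cell C Reg :=
  { s with idx := Function.update s.idx c n }

/-- The stacks that hold a state, for the bound `N` on the index variables. -/
def toStore (N : ℕ) (s : State Sym Cell C Reg) : Store Sym Cell (Option C) Reg where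
  reg := s.reg
  sym b := if b then [] else s.inp
  cell b := if b then [] else (List.range (N * N)).map fun p => s.mem (p / N) (p % N)
  cnt
    | .tmp => 0
    | .val none => 0
    | .rest none => N
    | .val (some c) => s.idx c
    | .rest (some c) => N - s.idx c
  out := []

/-- All index variables are below `N`. -/
def Bounded (N : ℕ) (s : State Sym Cell C Reg) : Prop :=
  ∀ c, s.idx c < N

theorem Bounded.setIdx {N : ℕ} {s : State Sym Cell C Reg} (h : s.Bounded N) (c : C) {n : ℕ}
    (hn : n < N) : (s.setIdx c n).Bounded N := by
  intro c'
  by_cases hc : c' = c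
  · subst hc; simpa [State.setIdx] using hn
  · simpa [State.setIdx, hc] using h c'

theorem toStore_setIdx (N : ℕ) (s : State Sym Cell C Reg) (c : C) (n : ℕ) :
    (s.setIdx c n).toStore N =
      (s.toStore N).setCnt (.val (some c)) (.rest (some c)) n (N - n) := by
  simp only [toStore, setIdx, Store.setCnt, Store.mk.injEq, true_and, and_true]
  funext k
  match k with
  | .tmp => simp
  | .val none => simp
  | .rest none => simp
  | .val (some c') =>
    by_cases hc : c' = c
    · subst hc; simp
    · simp [hc]
  | .rest (some c') =>
    by_cases hc : c' = c
    · subst hc; simp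
    · simp [hc]

end State

namespace Cmd

/-- The meaning of a program for the bound `N` on the index variables. -/
def run (N : ℕ) : Cmd Sym Cell C Reg → State Sym Cell C Reg → State Sym Cell C Reg
  | cell a b h, s =>
    { s with
      reg := (h s.reg (s.mem (s.idx a) (s.idx b))).1
      mem := Function.update s.mem (s.idx a) (Function.update (s.mem (s.idx a)) (s.idx b)
        (h s.reg (s.mem (s.idx a) (s.idx b))).2) }
  | next f, s => { s with reg := f s.reg s.inp.head?, inp := s.inp.tail }
  | inc c, s => s.setIdx c (if s.idx c + 1 < N then s.idx c + 1 else s.idx c)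
  | zero c, s => s.setIdx c 0
  | seq p q, s => q.run N (p.run N s)
  | ite b p q, s => if b s.reg then p.run N s else q.run N s
  | forEach c p, s => ((List.range N).foldl (fun s k => p.run N (s.setIdx c k)) s).setIdx c 0

/-- The program does not change the index variable `c`. -/
def Keeps (c : C) : Cmd Sym Cell C Reg → Prop
  | cell _ _ _ => True
  | next _ => True
  | inc c' => c ≠ c'
  | zero c' => c ≠ c'
  | seq p q => p.Keeps c ∧ q.Keeps c
  | ite _ p q => p.Keeps c ∧ q.Keeps c
  | forEach c' p => c ≠ c' ∧ p.Keeps c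

/-- No loop changes its own index variable. -/
def WellFormed : Cmd Sym Cell C Reg → Prop
  | seq p q => p.WellFormed ∧ q.WellFormed
  | ite _ p q => p.WellFormed ∧ q.WellFormed
  | forEach c p => p.Keeps c ∧ p.WellFormed
  | _ => True

theorem Keeps.idx_run {N : ℕ} {c : C} {p : Cmd Sym Cell C Reg} (h : p.Keeps c)
    (s : State Sym Cell C Reg) : (p.run N s).idx c = s.idx c := by
  induction p generalizing s with
  | cell | next => rfl
  | inc c' | zero c' => simp [run, State.setIdx, Function.update_of_ne h]
  | seq p q ihp ihq => rw [run, ihq h.2, ihp h.1]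
  | ite b p q ihp ihq =>
    rw [run]
    split_ifs
    exacts [ihp h.1 _, ihq h.2 _]
  | forEach c' p ih =>
    simp only [run, State.setIdx, Function.update_of_ne h.1]
    induction List.range N generalizing s with
    | nil => rfl
    | cons k l ih' => simp [ih', ih h.2, Function.update_of_ne h.1]

theorem bounded_run {N : ℕ} (hN : 0 < N) (p : Cmd Sym Cell C Reg) {s : State Sym Cell C Reg}
    (h : s.Bounded N) : (p.run N s).Bounded N := by
  induction p generalizing s with
  | cell | next => exact h
  | inc c =>
    refine h.setIdx c ?_
    split_ifs with h'
    exacts [h', h c]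
  | zero c => exact h.setIdx c hN
  | seq p q ihp ihq => exact ihq (ihp h)
  | ite b p q ihp ihq =>
    rw [run]
    split_ifs
    exacts [ihp h, ihq h]
  | forEach c p ih =>
    refine State.Bounded.setIdx ?_ c hN
    suffices ∀ l : List ℕ, (∀ k ∈ l, k < N) → ∀ s : State Sym Cell C Reg, s.Bounded N →
        (l.foldl (fun s k => p.run N (s.setIdx c k)) s).Bounded N from
      this _ (fun k hk => List.mem_range.1 hk) s h
    intro l
    induction l with
    | nil => exact fun _ _ h => h
    | cons k l ih' =>
      intro hl s hs
      exact ih' (fun k hk => hl k (by simp [hk])) _ (ih (hs.setIdx c (hl k (by simp))))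

/-- Bounds the unread input that has to be wiped at the end. -/
theorem length_inp_run_le {N : ℕ} (p : Cmd Sym Cell C Reg) (s : State Sym Cell C Reg) :
    (p.run N s).inp.length ≤ s.inp.length := by
  induction p generalizing s with
  | cell | inc | zero => rfl
  | next => simp [run]
  | seq p q ihp ihq => exact (ihq _).trans (ihp _)
  | ite b p q ihp ihq =>
    rw [run]
    split_ifs
    exacts [ihp _, ihq _]
  | forEach c p ih =>
    change (State.inp (List.foldl _ _ _)).length ≤ _
    induction List.range N generalizing s with
    | nil => rfl
    | cons k l ih' => exact (ih' _).trans (ih _)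

/-- The stack program that implements a bounded program. -/
def compile : Cmd Sym Cell C Reg → MProg Sym Cell (Option C) Reg
  | cell a b h => access none (some a) (some b) h
  | next f => .instr (.pop (.sym false) fun v x => { v with reg := f v.reg x })
  | inc c => .seq (moveUnit (.rest (some c)) (.val (some c)))
      (.seq (test (.cnt (.rest (some c))))
        (.ite (fun v => v.flag) (.instr (.load id)) (moveUnit (.val (some c)) (.rest (some c)))))
  | zero c => drain (.val (some c)) (.rest (some c))
  | seq p q => .seq p.compile q.compile
  | ite b p q => .ite (fun v => b v.reg) p.compile q.compile
  | forEach c p => .seq (drain (.val (some c)) (.rest (some c)))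
      (.seq (whileNonempty (.cnt (.rest (some c)))
          (.seq p.compile (moveUnit (.rest (some c)) (.val (some c)))))
        (drain (.val (some c)) (.rest (some c))))

/-- The bound is `≤` and not `<` because the passes of a `forEach` end with the index equal to `N`.
-/
theorem does_drain_val {N : ℕ} (c : C) (s : State Sym Cell C Reg) (h : s.idx c ≤ N) :
    Does (drain (.val (some c)) (.rest (some c))) (N * 4 + 2) (s.toStore N)
      ((s.setIdx c 0).toStore N) := by
  have := does_drain (a := .val (some c)) (b := .rest (some c)) (by simp) (s.toStore N)
  refine (Does.mono this ?_ : Does _ (N * 4 + 2) _ _).congr_right ?_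
  · simp [State.toStore]; lia
  · rw [State.toStore_setIdx]
    congr 1
    simp [State.toStore]; lia

theorem does_incr {N : ℕ} (c : C) (s : State Sym Cell C Reg) :
    Does (moveUnit (.rest (some c)) (.val (some c))) 2 (s.toStore N)
      ((s.setIdx c (s.idx c + 1)).toStore N) := by
  have := does_moveUnit (a := .rest (some c)) (b := .val (some c)) (by simp) (s.toStore N)
  refine this.congr_right ?_
  rw [State.toStore_setIdx, Store.setCnt_comm _ (by simp)]
  congr 1

theorem does_decr {N : ℕ} (c : C) (s : State Sym Cell C Reg) (h : s.idx c ≤ N) (h0 : s.idx c ≠ 0) :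
    Does (moveUnit (.val (some c)) (.rest (some c))) 2 (s.toStore N)
      ((s.setIdx c (s.idx c - 1)).toStore N) := by
  have := does_moveUnit (a := .val (some c)) (b := .rest (some c)) (by simp) (s.toStore N)
  refine this.congr_right ?_
  rw [State.toStore_setIdx]
  congr 1
  simp [State.toStore]; lia

/-- Division with remainder by `N` recovers row and column from a list position, so updating one
list entry changes exactly one matrix cell. -/
theorem does_access_toStore {N : ℕ} (a b : C) (h : Reg → Cell → Reg × Cell)
    (s : State Sym Cell C Reg) (hs : s.Bounded N) :
    Does (access none (some a) (some b) h) (14 * N * N + 26 * N + 12) (s.toStore N)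
      (((cell a b h).run N s).toStore N) := by
  have hN : 0 < N := (Nat.zero_le _).trans_lt (hs a)
  set l := (List.range (N * N)).map fun p => s.mem (p / N) (p % N) with hl
  have hp : s.idx a * N + s.idx b < N * N := by
    have := hs a
    have := hs b
    nlinarith
  have hdiv : (s.idx a * N + s.idx b) / N = s.idx a := by
    rw [Nat.mul_comm, Nat.mul_add_div hN, Nat.div_eq_of_lt (hs b), Nat.add_zero]
  have hmod : (s.idx a * N + s.idx b) % N = s.idx b := by
    rw [Nat.mul_comm, Nat.mul_add_mod, Nat.mod_eq_of_lt (hs b)]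
  have key := does_access (N := N) (w := none) (a := some a) (b := some b) h (s.toStore N) l
    (by simp [hl]) (by simp) rfl rfl rfl (hs a)
    (by rw [hl, List.length_map, List.length_range]; exact hp)
  have hget : l[s.idx a * N + s.idx b]'(by simpa [hl] using hp) = s.mem (s.idx a) (s.idx b) := by
    simp [hl, hdiv, hmod]
  change Does _ _ (s.toStore N) (Store.atPos { s.toStore N with reg :=
    (h s.reg (l[s.idx a * N + s.idx b]'(by simpa [hl] using hp))).1 }
      (l.set (s.idx a * N + s.idx b)
        (h s.reg (l[s.idx a * N + s.idx b]'(by simpa [hl] using hp))).2) 0) at key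
  refine key.congr_right ?_
  simp only [hget, Store.atPos, State.toStore, run, Store.mk.injEq, true_and, and_true]
  funext b'
  cases b'
  · simp only [Bool.false_eq_true, if_false, List.drop_zero]
    refine List.ext_getElem (by simp [hl]) fun p h1 h2 => ?_
    simp only [hl, List.getElem_set, List.getElem_map, List.getElem_range]
    by_cases ha : p / N = s.idx a
    · by_cases hb : p % N = s.idx b
      · have : s.idx a * N + s.idx b = p := by
          rw [← ha, ← hb, Nat.mul_comm]; exact Nat.div_add_mod p N
        simp [this, ha, hb]
      · have : s.idx a * N + s.idx b ≠ p := by rintro rfl; exact hb hmod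
        simp [this, ha, hb]
    · have : s.idx a * N + s.idx b ≠ p := by rintro rfl; exact ha hdiv
      simp [this, ha]
  · simp

theorem does_compile {N : ℕ} {p : Cmd Sym Cell C Reg} (hp : p.WellFormed)
    {s : State Sym Cell C Reg} (hs : s.Bounded N) (hN : 0 < N) :
    Does p.compile (p.cost N) (s.toStore N) ((p.run N s).toStore N) := by
  induction p generalizing s with
  | cell a b h => exact does_access_toStore a b h s hs
  | next f =>
    refine .instr (fun v hv => ?_) fun v _ => ?_
    · simp [Instr.apply, run, State.toStore, Store.stk, hv]
    · funext k
      cases k with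
      | sym b => cases b <;> simp [Instr.apply, run, State.toStore, Store.stk]
      | _ => simp [Instr.apply, run, State.toStore, Store.stk]
  | inc c =>
    have hc := hs c
    -- The index is raised and then lowered again if its `rest` stack became empty, so it saturates
    -- at `N - 1`.
    refine Does.mono (T := 2 + (2 + 2)) (Does.seq (does_incr c s)
      (does_iteNonempty (fun h => ?_) fun h => ?_)) le_rfl
    · have : s.idx c + 1 < N := by
        simp [Store.stk, State.toStore, State.setIdx] at h
        lia
      simp only [run, this, if_true]
      exact (does_skip _).mono (by lia)
    · have : ¬ s.idx c + 1 < N := by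
        simp [Store.stk, State.toStore, State.setIdx] at h
        lia
      refine (does_decr c _ (by simpa [State.setIdx] using hc)
        (by simp [State.setIdx])).congr_right ?_
      simp [run, this, State.setIdx]
  | zero c => exact does_drain_val c s (hs c).le
  | seq p q ihp ihq => exact (ihp hp.1 hs).seq (ihq hp.2 (bounded_run hN p hs))
  | ite b p q ihp ihq =>
    refine Does.ite (fun h => ?_) fun h => ?_
    · exact (ihp hp.1 hs).mono (by lia) |>.congr_right (by simp [run, show b s.reg = true from h])
    · exact (ihq hp.2 hs).mono (by lia) |>.congr_right (by simp [run, show b s.reg = false from h])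
  | forEach c p ih =>
    set g : ℕ → State Sym Cell C Reg := fun i =>
      (List.range i).foldl (fun s k => p.run N (s.setIdx c k)) s with hg
    have hgs : ∀ i, g (i + 1) = p.run N ((g i).setIdx c i) := fun i => by
      simp [hg, List.range_succ]
    have hb : ∀ i, i ≤ N → ∀ k < N, ((g i).setIdx c k).Bounded N := by
      intro i
      induction i with
      | zero => exact fun _ k hk => hs.setIdx c hk
      | succ i ihi =>
        intro hi k hk
        rw [hgs]
        exact (bounded_run hN p (ihi (by lia) i (by lia))).setIdx c hk
    -- After the passes the index is `N`, which no `Bounded` state allows, so the store before the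
    -- final drain is named explicitly.
    refine (does_drain_val c s (hs c).le).seq (Does.seq (s' := ((g N).setIdx c N).toStore N) ?_ ?_)
    · refine Does.whileNonempty (n := N) (fun i => ((g i).setIdx c i).toStore N) ?_ ?_ ?_
      · intro i hi
        refine (ih hp.2 (hb i hi.le i hi)).seq ((does_incr c _).congr_right ?_)
        have := hp.1.idx_run (N := N) ((g i).setIdx c i)
        rw [this, ← hgs]
        simp [State.setIdx]
      · intro i hi
        simp [Store.stk, State.toStore, State.setIdx]
        lia
      · simp [Store.stk, State.toStore, State.setIdx]
    · refine (does_drain_val c _ (by simp [State.setIdx])).congr_right ?_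
      simp [State.setIdx, run, hg]

end Cmd

end StackProgram

/-! ### Bounded programs run in polynomial time on a multi-stack machine -/

namespace StackProgram

open Turing

variable {Sym Cell C Reg : Type}

namespace Store

/-- Replace the contents of one stack. -/
def setStk [DecidableEq C] (s : Store Sym Cell C Reg) :
    (k : Stack C) → List (Alphabet Sym Cell C k) → Store Sym Cell C Reg
  | .sym b, l => { s with sym := Function.update s.sym b l }
  | .cell b, l => { s with cell := Function.update s.cell b l }
  | .cnt n, l => { s with cnt := Function.update s.cnt n l.length }
  | .out, l => { s with out := l }

theorem stk_setStk [DecidableEq C] (s : Store Sym Cell C Reg) (k : Stack C)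
    (l : List (Alphabet Sym Cell C k)) : (s.setStk k l).stk = Function.update s.stk k l := by
  cases k with
  | sym b => exact (update_stk_sym s b l).symm
  | cell b => exact (update_stk_cell s b l).symm
  | cnt n =>
    have hl : l = List.replicate l.length () := List.eq_replicate_length.2 fun _ _ => rfl
    conv_rhs => rw [hl]
    exact (update_stk_cnt s n _).symm
  | out => exact (update_stk_out s l).symm

theorem reg_setStk [DecidableEq C] (s : Store Sym Cell C Reg) (k : Stack C)
    (l : List (Alphabet Sym Cell C k)) : (s.setStk k l).reg = s.reg := by
  cases k <;> rfl

theorem ext_stk {s s' : Store Sym Cell C Reg} (hr : s.reg = s'.reg) (h : s.stk = s'.stk) :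
    s = s' := by
  ext1
  · exact hr
  · funext b; exact congrFun h (.sym b)
  · funext b; exact congrFun h (.cell b)
  · funext n
    have := congrArg List.length (congrFun h (.cnt n))
    simpa [stk] using this
  · exact congrFun h .out

end Store

variable [DecidableEq C]

/-- Empty a stack. -/
def clear (k : Stack C) : MProg Sym Cell C Reg :=
  whileNonempty k (.instr (.pop k fun v _ => v))

theorem does_clear (k : Stack C) (s : Store Sym Cell C Reg) :
    Does (clear k) ((s.stk k).length * 3 + 2) s (s.setStk k []) := by
  have key := Does.whileNonempty (k := k) (p := .instr (.pop k fun v _ => v)) (T := 1)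
    (n := (s.stk k).length) (fun i => s.setStk k ((s.stk k).drop i)) ?_ ?_ ?_
  · have h0 : s.setStk k ((s.stk k).drop 0) = s :=
      Store.ext_stk (Store.reg_setStk _ _ _) (by simp [Store.stk_setStk])
    simp only [h0, List.drop_length] at key
    exact key
  · intro i hi
    refine .instr (fun v hv => by simpa [Store.reg_setStk, Instr.apply] using hv) fun v hv => ?_
    simp [Store.stk_setStk, Instr.apply]
  · intro i hi
    simpa [Store.stk_setStk] using hi
  · simp [Store.stk_setStk]

/-- Empty all stacks of a list. -/
def clearAll : List (Stack C) → MProg Sym Cell C Reg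
  | [] => .instr (.load id)
  | k :: l => .seq (clear k) (clearAll l)

/-- The machine must halt with every stack except the output empty. A common bound `B` on all stack
heights makes the cost independent of their contents. -/
theorem does_clearAll (B : ℕ) (l : List (Stack C)) (s : Store Sym Cell C Reg)
    (hB : ∀ k, (s.stk k).length ≤ B) :
    ∃ s', s'.reg = s.reg ∧ (∀ k, s'.stk k = if k ∈ l then [] else s.stk k) ∧
      Does (clearAll l) (l.length * (B * 3 + 2) + 1) s s' := by
  induction l generalizing s with
  | nil => exact ⟨s, rfl, by simp, (does_skip s).mono (by lia)⟩
  | cons k l ih =>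
    have h1 : ∀ k', (s.setStk k []).stk k' = if k' = k then [] else s.stk k' := by
      intro k'
      rw [Store.stk_setStk]
      by_cases h : k' = k
      · subst h; simp
      · simp [h]
    obtain ⟨s', hr, hs', hd⟩ := ih (s.setStk k []) fun k' => by
      rw [h1]
      split_ifs
      exacts [Nat.zero_le _, hB k']
    refine ⟨s', hr.trans (Store.reg_setStk _ _ _), fun k' => ?_,
      ((does_clear k s).seq hd).mono ?_⟩
    · rw [hs', h1]
      by_cases h : k' = k <;> by_cases h' : k' ∈ l <;> simp [h, h']
    · have := hB k
      simp only [List.length_cons]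
      nlinarith

/-- Move a symbol from the stack `sym b` to the other stack of symbols. -/
def moveSym (b : Bool) : MProg Sym Cell C Reg :=
  .seq (.instr (.pop (.sym b) fun v x => { v with sym := x.getD v.sym }))
    (.instr (.push (.sym !b) fun v => v.sym))

theorem does_moveSym (s : Store Sym Cell C Reg) (b : Bool) (x : Sym) (l : List Sym)
    (h : s.sym b = x :: l) :
    Does (moveSym b) 2 s { s with sym := fun b' => if b' = b then l else x :: s.sym b' } := by
  intro v hv
  refine ⟨2, le_rfl, { v with sym := x }, hv, .instr_seq_instr ?_⟩
  have h' : s.stk (.sym b) = x :: l := h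
  simp only [Instr.apply, h', List.head?_cons, List.tail_cons, Option.getD_some, Prod.mk.injEq,
    true_and]
  rw [Store.update_stk_sym, Store.update_stk_sym]
  congr 2
  funext b'
  cases b <;> cases b' <;> simp [Store.stk]

/-- Increment the bound of all counters of a list. -/
def raiseAll : List C → MProg Sym Cell C Reg
  | [] => .instr (.load id)
  | c :: l => .seq (pushUnit (.rest c)) (raiseAll l)

/-- The store in which all counters have value `0` and bound `m`. -/
def Store.fresh (r : Reg) (sym : Bool → List Sym) (l : List Cell) (m : ℕ) :
    Store Sym Cell C Reg where
  reg := r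
  sym := sym
  cell b := if b then [] else l
  cnt
    | .rest _ => m
    | _ => 0
  out := []

theorem does_raiseAll (l : List C) (hl : l.Nodup) (s : Store Sym Cell C Reg) :
    Does (raiseAll l) (l.length + 1) s { s with cnt := fun
      | .rest c => if c ∈ l then s.cnt (.rest c) + 1 else s.cnt (.rest c)
      | k => s.cnt k } := by
  induction l generalizing s with
  | nil =>
    refine ((does_skip s).mono (by simp)).congr_right ?_
    ext1 <;> try rfl
    funext k
    cases k <;> simp
  | cons c l ih =>
    refine (((does_pushUnit (.rest c) s).seq (ih hl.of_cons _)).mono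
      (by simp; lia)).congr_right ?_
    have hc : c ∉ l := (List.nodup_cons.1 hl).1
    ext1 <;> try rfl
    funext k
    cases k with
    | rest c' =>
      by_cases h : c' = c
      · subst h; simp [hc]
      · simp [h]
    | _ => simp

section Fill

variable [Inhabited Cell]

/-- The store with a cell memory of `n` default cells. -/
def Store.withCells (s : Store Sym Cell C Reg) (n : ℕ) : Store Sym Cell C Reg :=
  { s with cell := fun b => if b then [] else List.replicate n default }

theorem does_pushCell (s : Store Sym Cell C Reg) (n : ℕ) :
    Does (.instr (.push (.cell false) fun _ => default)) 1 (s.withCells n)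
      (s.withCells (n + 1)) := by
  refine .instr (fun v hv => hv) fun v _ => ?_
  simp only [Instr.apply]
  rw [Store.update_stk_cell]
  congr 1
  ext1 <;> try rfl
  funext b
  cases b <;> simp [Store.withCells, Store.stk, List.replicate_succ]

/-- Push as many default cells as the bound of the counters says, using the counter `w`. -/
def fillRow (w : C) : MProg Sym Cell C Reg :=
  .seq (whileNonempty (.cnt (.rest w)) (.seq (moveUnit (.rest w) (.val w))
    (.instr (.push (.cell false) fun _ => default)))) (drain (.val w) (.rest w))

theorem does_fillRow {w : C} {N : ℕ} (s : Store Sym Cell C Reg) (n : ℕ)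
    (hr : s.cnt (.rest w) = N) (hv : s.cnt (.val w) = 0) :
    Does (fillRow w) (N * 9 + 4) (s.withCells n) (s.withCells (n + N)) := by
  have hne : Counter.rest w ≠ .val w := by simp
  have key := Does.whileNonempty (k := .cnt (.rest w)) (p := .seq (moveUnit (.rest w) (.val w))
    (.instr (.push (.cell false) fun _ => default))) (T := 2 + 1) (n := N)
    (fun i => (s.setCnt (.rest w) (.val w) (N - i) i).withCells (n + i)) ?_ ?_ ?_
  · rw [show (s.setCnt (.rest w) (.val w) (N - 0) 0).withCells (n + 0) = s.withCells n by
      rw [Store.setCnt_eq_self (by simpa using hr) hv]; simp] at key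
    refine ((Does.seq key (does_drain hne.symm _)).mono ?_).congr_right ?_
    · simp [Store.withCells, Store.setCnt]
      lia
    · change ((s.setCnt (.rest w) (.val w) (N - N) N).setCnt (.val w) (.rest w) _ _).withCells
        (n + N) = _
      rw [Store.setCnt_swap _ hne]
      congr 1
      exact Store.setCnt_eq_self (by simp [Store.withCells, Store.setCnt, hr]) (by simp [hv])
  · intro i hi
    refine Does.seq (does_moveUnit hne _) ?_
    rw [← Nat.add_assoc]
    convert does_pushCell (s.setCnt (.rest w) (.val w) (N - (i + 1)) (i + 1)) (n + i) using 1
    change ((s.setCnt (.rest w) (.val w) (N - i) i).setCnt (.rest w) (.val w) _ _).withCells _ = _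
    rw [Store.setCnt_setCnt _ hne]
    congr 2
    · simp [Store.withCells, Store.setCnt]; lia
    · simp [Store.withCells, Store.setCnt]
  · intro i hi
    simp [Store.stk, Store.withCells, Store.setCnt]
    lia
  · simp [Store.stk, Store.withCells, Store.setCnt]

/-- Fill the cell memory with a square of default cells. -/
def fill (w c : C) : MProg Sym Cell C Reg :=
  .seq (whileNonempty (.cnt (.rest c)) (.seq (moveUnit (.rest c) (.val c)) (fillRow w)))
    (drain (.val c) (.rest c))

/-- The outer loop counts rows with `c` while each row uses and restores `w`, hence `w ≠ c`. -/
theorem does_fill {w c : C} (hwc : w ≠ c) {N : ℕ} (s : Store Sym Cell C Reg)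
    (hr : s.cnt (.rest w) = N) (hv : s.cnt (.val w) = 0)
    (hr' : s.cnt (.rest c) = N) (hv' : s.cnt (.val c) = 0) :
    Does (fill w c) (N * (N * 9 + 12) + 4) (s.withCells 0) (s.withCells (N * N)) := by
  have hne : Counter.rest c ≠ .val c := by simp
  have key := Does.whileNonempty (k := .cnt (.rest c)) (p := .seq (moveUnit (.rest c) (.val c))
    (fillRow w)) (T := 2 + (N * 9 + 4)) (n := N)
    (fun i => (s.setCnt (.rest c) (.val c) (N - i) i).withCells (i * N)) ?_ ?_ ?_
  · rw [show (s.setCnt (.rest c) (.val c) (N - 0) 0).withCells (0 * N) = s.withCells 0 by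
      rw [Store.setCnt_eq_self (by simpa using hr') hv']; simp] at key
    refine ((Does.seq key (does_drain hne.symm _)).mono ?_).congr_right ?_
    · simp [Store.withCells, Store.setCnt]
      lia
    · change ((s.setCnt (.rest c) (.val c) (N - N) N).setCnt (.val c) (.rest c) _ _).withCells
        (N * N) = _
      rw [Store.setCnt_swap _ hne]
      congr 1
      exact Store.setCnt_eq_self (by simp [Store.withCells, Store.setCnt, hr']) (by simp [hv'])
  · intro i hi
    refine Does.seq (does_moveUnit hne _) ?_
    have := does_fillRow (w := w) (N := N)
      (s.setCnt (.rest c) (.val c) (N - (i + 1)) (i + 1)) (i * N)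
      (by simp [Store.setCnt, hwc, hr]) (by simp [Store.setCnt, hwc, hv])
    rw [← Nat.succ_mul] at this
    convert this using 1
    change ((s.setCnt (.rest c) (.val c) (N - i) i).setCnt (.rest c) (.val c) _ _).withCells _ = _
    rw [Store.setCnt_setCnt _ hne]
    congr 2
    · simp [Store.withCells, Store.setCnt]; lia
    · simp [Store.withCells, Store.setCnt]
  · intro i hi
    simp [Store.stk, Store.withCells, Store.setCnt]
    lia
  · simp [Store.stk, Store.withCells, Store.setCnt]

end Fill

variable [Fintype C]

/-- Increment the bound of all counters. -/
noncomputable def raise : MProg Sym Cell C Reg :=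
  raiseAll (Finset.univ : Finset C).toList

theorem does_raise (r : Reg) (sym : Bool → List Sym) (l : List Cell) (m : ℕ) :
    Does (C := C) raise (Fintype.card C + 1) (.fresh r sym l m) (.fresh r sym l (m + 1)) := by
  refine ((does_raiseAll _ (Finset.nodup_toList _) _).mono (by simp)).congr_right ?_
  ext1 <;> try rfl
  funext k
  cases k <;> simp [Store.fresh]

/-- Set the bound of all counters to one more than the length of the input. -/
noncomputable def measure : MProg Sym Cell C Reg :=
  .seq raise (.seq (whileNonempty (.sym false) (.seq (moveSym false) raise))
    (whileNonempty (.sym true) (moveSym true)))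

/-- The input is reversed onto the other symbol stack, all bounds being raised once per symbol, and
then moved back. The extra raise at the start makes the bound positive even for empty input. -/
theorem does_measure (r : Reg) (w : List Sym) (l : List Cell) :
    Does (C := C) measure (w.length * (Fintype.card C + 9) + Fintype.card C + 5)
      (.fresh r (fun b => if b then [] else w) l 0)
      (.fresh r (fun b => if b then [] else w) l (w.length + 1)) := by
  set z : ℕ → Bool → List Sym := fun p b => if b then (w.take p).reverse else w.drop p with hz
  have hz0 : (fun b => if b then [] else w) = z 0 := by
    funext b; cases b <;> simp [hz]
  have h₁ : ∀ m p, p < w.length → Does (C := C) (moveSym false) 2 (.fresh r (z p) l m)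
      (.fresh r (z (p + 1)) l m) := by
    intro m p hp
    refine (does_moveSym _ false w[p] (w.drop (p + 1)) (by simp [Store.fresh, hz])).congr_right ?_
    ext1 <;> try rfl
    funext b
    cases b
    · simp [Store.fresh, hz]
    · simp only [Store.fresh, hz, if_true, List.take_succ_eq_append_getElem hp, List.reverse_append,
        List.reverse_singleton]
      rfl
  have h₂ : ∀ m p, p < w.length → Does (C := C) (moveSym true) 2 (.fresh r (z (p + 1)) l m)
      (.fresh r (z p) l m) := by
    intro m p hp
    refine (does_moveSym _ true w[p] (w.take p).reverse ?_).congr_right ?_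
    · simp only [Store.fresh, hz, if_true, List.take_succ_eq_append_getElem hp, List.reverse_append,
        List.reverse_singleton]
      rfl
    · ext1 <;> try rfl
      funext b
      cases b <;> simp [Store.fresh, hz]
  have k₁ := Does.whileNonempty (k := .sym false) (p := .seq (moveSym false) raise)
    (T := 2 + (Fintype.card C + 1)) (n := w.length)
    (fun i => Store.fresh (C := C) r (z i) l (i + 1))
    (fun i hi => (h₁ _ i hi).seq (does_raise _ _ _ _))
    (fun i hi => by simpa [Store.stk, Store.fresh, hz] using hi)
    (by simp [Store.stk, Store.fresh, hz])
  have k₂ := Does.whileNonempty (k := .sym true) (p := moveSym true)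
    (T := 2) (n := w.length)
    (fun i => Store.fresh (C := C) r (z (w.length - i)) l (w.length + 1))
    (fun i hi => by
      have := h₂ (w.length + 1) (w.length - (i + 1)) (by lia)
      rwa [show w.length - (i + 1) + 1 = w.length - i by lia] at this)
    (fun i hi => by
      have h1 : w.length - i ≠ 0 := by lia
      have h2 : w ≠ [] := by rintro rfl; simp at hi
      simp [Store.stk, Store.fresh, hz, h1, h2])
    (by simp [Store.stk, Store.fresh, hz])
  rw [Nat.sub_self] at k₂
  rw [hz0]
  refine ((does_raise _ _ _ _).seq (k₁.seq k₂)).mono ?_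
  nlinarith

/-! ### The machine -/

section Machine

variable [Inhabited Cell] [Inhabited Sym]

/-- The stack program that prepares the stacks, runs a bounded program and leaves its answer. -/
noncomputable def wholeProgram (p : Cmd Sym Cell C Reg) (c : C) (r : Reg) (ans : Reg → Bool) :
    MProg Sym Cell (Option C) Reg :=
  .seq measure (.seq (fill none (some c)) (.seq p.compile
    (.seq (clearAll (Finset.univ : Finset (Stack (Option C))).toList)
      (.seq (.instr (.push .out fun v => ans v.reg))
        (.instr (.load fun _ => ⟨r, false, default, default⟩))))))

/-- A bound on the number of steps of the whole program on inputs of length `L`. -/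
def wholeCost (p : Cmd Sym Cell C Reg) (L : ℕ) : ℕ :=
  (L * (Fintype.card (Option C) + 9) + Fintype.card (Option C) + 5) +
    (((L + 1) * ((L + 1) * 9 + 12) + 4) + (p.cost (L + 1) +
      ((Fintype.card (Stack (Option C)) * (((L + 1) * (L + 1) + (L + 1)) * 3 + 2) + 1) + 2)))

/-- The initial state of a bounded program. -/
def State.init (r : Reg) (w : List Sym) : State Sym Cell C Reg :=
  ⟨r, w, fun _ => 0, fun _ _ => default⟩

theorem exec_wholeProgram {p : Cmd Sym Cell C Reg} (hp : p.WellFormed) (c : C) (r : Reg)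
    (ans : Reg → Bool) (w : List Sym) :
    ∃ t ≤ wholeCost p w.length, Prog.Exec (wholeProgram p c r ans)
      (⟨r, false, default, default⟩, Function.update (fun _ => []) (.sym false) w) t
      (⟨r, false, default, default⟩, Function.update (fun _ => []) .out
        [ans (p.run (w.length + 1) (State.init r w)).reg]) := by
  set N := w.length + 1 with hN
  have h₁ := does_measure (C := Option C) (Cell := Cell) r w []
  have h₂ := does_fill (Cell := Cell) (w := none) (c := some c) (N := N) (by simp)
    (Store.fresh r (fun b => if b then [] else w) [] N) rfl rfl rfl rfl
  have e₁ : (Store.fresh (C := Option C) (Cell := Cell) r (fun b => if b then [] else w) [] N)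
      = (Store.fresh r (fun b => if b then [] else w) [] N).withCells 0 := by
    ext1 <;> rfl
  have e₂ : (Store.fresh (C := Option C) (Cell := Cell) r (fun b => if b then [] else w) []
      N).withCells (N * N) = (State.init r w).toStore N := by
    ext1 <;> try rfl
    · funext b
      cases b
      · simp [Store.withCells, State.toStore, State.init]
      · rfl
    · funext k
      match k with
      | .tmp | .val none | .rest none | .val (some c) | .rest (some c) => rfl
  rw [← hN, e₁] at h₁
  rw [e₂] at h₂
  have hb : (State.init r w : State Sym Cell C Reg).Bounded N := fun c => Nat.succ_pos _
  have h₃ := Cmd.does_compile hp hb (Nat.succ_pos _)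
  have hb' := Cmd.bounded_run (Nat.succ_pos _) p hb
  have hi := Cmd.length_inp_run_le (N := N) p (State.init (C := C) (Cell := Cell) r w)
  set s := p.run N (State.init r w) with hs
  -- `N * N` covers the cell memory; `N` covers the unread input and each counter.
  obtain ⟨s', hr', hs', h₄⟩ := does_clearAll (N * N + N)
    (Finset.univ : Finset (Stack (Option C))).toList (s.toStore N) (by
      intro k
      match k with
      | .sym true => simp [Store.stk, State.toStore]
      | .sym false =>
        have : s.inp.length ≤ w.length := hi
        simp only [Store.stk, State.toStore, Bool.false_eq_true, if_false]
        lia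
      | .cell true => simp [Store.stk, State.toStore]
      | .cell false => simp [Store.stk, State.toStore]
      | .out => simp [Store.stk, State.toStore]
      | .cnt .tmp => simp [Store.stk, State.toStore]
      | .cnt (.val none) => simp [Store.stk, State.toStore]
      | .cnt (.rest none) => simp [Store.stk, State.toStore]
      | .cnt (.val (some c)) =>
        have := hb' c
        simp only [Store.stk, State.toStore, List.length_replicate]
        lia
      | .cnt (.rest (some c)) =>
        simp only [Store.stk, State.toStore, List.length_replicate]
        lia)
  have hstk : s'.stk = fun _ => [] := by
    funext k
    simp [hs']
  obtain ⟨t₁, ht₁, v₁, hv₁, x₁⟩ := h₁ ⟨r, false, default, default⟩ rfl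
  obtain ⟨t₂, ht₂, v₂, hv₂, x₂⟩ := h₂ v₁ hv₁
  obtain ⟨t₃, ht₃, v₃, hv₃, x₃⟩ := h₃ v₂ hv₂
  obtain ⟨t₄, ht₄, v₄, hv₄, x₄⟩ := h₄ v₃ hv₃
  refine ⟨t₁ + (t₂ + (t₃ + (t₄ + 2))), ?_, ?_⟩
  · simp only [Finset.length_toList, Finset.card_univ] at ht₄
    unfold wholeCost
    lia
  · have e₀ : Function.update (β := fun k => List (Alphabet Sym Cell (Option C) k)) (fun _ => [])
        (.sym false) w =
        (Store.fresh (C := Option C) (Cell := Cell) r (fun b => if b then [] else w) [] 0).stk := by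
      funext k
      match k with
      | .sym true | .sym false | .cell true | .cell false | .out => simp [Store.stk, Store.fresh]
      | .cnt k => cases k <;> simp [Store.stk, Store.fresh]
    rw [e₀]
    -- The last `load` resets the local state, since the required halting configuration carries the
    -- initial one.
    refine x₁.seq (x₂.seq (x₃.seq (x₄.seq (.instr_seq_instr ?_))))
    simp only [Instr.apply, hstk, Prod.mk.injEq, true_and]
    rw [show v₄.reg = s.reg from hv₄.trans hr']

/-- The machine that executes the whole program. -/
noncomputable def machine [Fintype Sym] [Fintype Cell] [Fintype Reg] (p : Cmd Sym Cell C Reg)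
    (c : C) (r : Reg) (ans : Reg → Bool) : FinTM2 :=
  let P := wholeProgram p c r ans
  let _ := P.labelFintype
  { K := Stack (Option C)
    k₀ := .sym false
    k₁ := .out
    Γ := Alphabet Sym Cell (Option C)
    Λ := Option P.Label
    main := some P.entry
    σ := Local Sym Cell Reg
    initialState := ⟨r, false, default, default⟩
    Γk₀Fin := inferInstanceAs (Fintype Sym)
    m := fun
      | none => .halt
      | some l => P.code some none l }

theorem initList_machine [Fintype Sym] [Fintype Cell] [Fintype Reg] (p : Cmd Sym Cell C Reg)
    (c : C) (r : Reg) (ans : Reg → Bool) (w : List Sym) :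
    initList (machine p c r ans) (w.map (Equiv.refl Sym).invFun) =
      ⟨some (some (wholeProgram p c r ans).entry), ⟨r, false, default, default⟩,
        Function.update (fun _ => []) (.sym false) w⟩ := by
  refine (congrArg (initList (machine p c r ans)) (List.map_id w)).trans ?_
  refine congrArg (TM2.Cfg.mk _ _) (funext fun k => ?_)
  match k with
  | .sym false | .sym true | .cell _ | .cnt _ | .out => rfl

theorem haltList_machine [Fintype Sym] [Fintype Cell] [Fintype Reg] (p : Cmd Sym Cell C Reg)
    (c : C) (r : Reg) (ans : Reg → Bool) (b : Bool) :
    haltList (machine p c r ans) ((Computability.encodeBool b).map (Equiv.refl Bool).invFun) =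
      ⟨none, ⟨r, false, default, default⟩, Function.update (fun _ => []) .out [b]⟩ := by
  refine congrArg (TM2.Cfg.mk _ _) (funext fun k => ?_)
  match k with
  | .sym _ | .cell _ | .cnt _ | .out => rfl

theorem nonempty_computableInPolyTime [Fintype Sym] [Fintype Cell] [Fintype Reg] {α : Type}
    (enc : α → List Sym) {p : Cmd Sym Cell C Reg} (hp : p.WellFormed) (c : C) (r : Reg)
    (ans : Reg → Bool) :
    Nonempty (TM2ComputableInPolyTime enc Computability.encodeBool fun a =>
      ans (p.run ((enc a).length + 1) (State.init r (enc a))).reg) := by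
  obtain ⟨P, hP⟩ := p.exists_polynomial_cost
  refine ⟨{
    tm := machine p c r ans
    inputAlphabet := Equiv.refl Sym
    outputAlphabet := Equiv.refl Bool
    -- This is `wholeCost` as a polynomial, plus one step for the halting statement at the label
    -- `none`.
    time := ((.X * (.C (Fintype.card (Option C)) + 9) + .C (Fintype.card (Option C)) + 5) +
      (((.X + 1) * ((.X + 1) * 9 + 12) + 4) + (P.comp (.X + 1) +
      ((.C (Fintype.card (Stack (Option C))) * (((.X + 1) * (.X + 1) + (.X + 1)) * 3 + 2) + 1) +
        2)))) + 1
    outputsFun := fun a => ?_ }⟩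
  have ex := exec_wholeProgram hp c r ans (enc a)
  refine Classical.choice ?_
  obtain ⟨t, ht, x⟩ := ex
  refine ⟨⟨⟨t + 1, ?_⟩, ?_⟩⟩
  · have := x.iterate_step (M := (machine p c r ans).m) some none (fun l => rfl)
    rw [Nat.add_comm, Function.iterate_add_apply]
    erw [initList_machine, this]
    exact congrArg some (haltList_machine p c r ans _).symm
  · simp [wholeCost, hP] at ht ⊢
    lia

end Machine

end StackProgram

/-! ### Bit-serial subtraction -/

/-- The number whose binary digits below position `m` are given by `f`. -/
def bitValue (f : ℕ → Bool) (m : ℕ) : ℕ :=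
  ∑ b ∈ Finset.range m, (f b).toNat * 2 ^ b

theorem bitValue_succ (f : ℕ → Bool) (m : ℕ) :
    bitValue f (m + 1) = bitValue f m + (f m).toNat * 2 ^ m :=
  Finset.sum_range_succ _ _

theorem bitValue_lt (f : ℕ → Bool) (m : ℕ) : bitValue f m < 2 ^ m := by
  induction m with
  | zero => simp [bitValue]
  | succ m ih =>
    have := Nat.mul_le_mul_right (2 ^ m) (Bool.toNat_le (f m))
    rw [bitValue_succ, pow_succ]
    lia

theorem bitValue_testBit (x m : ℕ) : bitValue x.testBit m = x % 2 ^ m := by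
  induction m with
  | zero => simp [bitValue, Nat.mod_one]
  | succ m ih => rw [bitValue_succ, ih, Nat.mod_pow_succ, Nat.toNat_testBit, Nat.mul_comm]

theorem bitValue_congr {f g : ℕ → Bool} {m : ℕ} (h : ∀ b < m, f b = g b) :
    bitValue f m = bitValue g m :=
  Finset.sum_congr rfl fun b hb => by rw [h b (Finset.mem_range.1 hb)]

/-- The next borrow when `y` is subtracted from `x` with borrow `c`. -/
def borrowBit (x y c : Bool) : Bool :=
  (!x && y) || ((!x || y) && c)

/-- The digit that results when `y` is subtracted from `x` with borrow `c`. -/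
def diffBit (x y c : Bool) : Bool :=
  x ^^ (y ^^ c)

theorem diffBit_add (x y c : Bool) :
    (diffBit x y c).toNat + y.toNat + c.toNat = x.toNat + 2 * (borrowBit x y c).toNat := by
  cases x <;> cases y <;> cases c <;> rfl

/-- The borrow before position `m` in the subtraction of `y` from `x` with initial borrow `c`. -/
def borrow (x y : ℕ → Bool) (c : Bool) : ℕ → Bool
  | 0 => c
  | m + 1 => borrowBit (x m) (y m) (borrow x y c m)

/-- Schoolbook subtraction: `diffBit_add`, scaled by `2 ^ m`, extends the identity by one column. -/
theorem bitValue_diff_add (x y : ℕ → Bool) (c : Bool) (m : ℕ) :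
    bitValue (fun b => diffBit (x b) (y b) (borrow x y c b)) m + bitValue y m + c.toNat =
      bitValue x m + (borrow x y c m).toNat * 2 ^ m := by
  induction m with
  | zero => simp [bitValue, borrow]
  | succ m ih =>
    have h := congrArg (· * 2 ^ m) (diffBit_add (x m) (y m) (borrow x y c m))
    simp only [add_mul] at h
    rw [bitValue_succ, bitValue_succ, bitValue_succ, borrow, pow_succ]
    lia

/-- The difference digits have value below `2 ^ m`, so the last borrow records exactly an underflow.
The initial borrow `c` switches the test between `<` and `≤`, which later serves to break ties. -/
theorem borrow_eq_decide (x y : ℕ → Bool) (c : Bool) (m : ℕ) :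
    borrow x y c m = decide (bitValue x m < bitValue y m + c.toNat) := by
  have h := bitValue_diff_add x y c m
  have h' := bitValue_lt (fun b => diffBit (x b) (y b) (borrow x y c b)) m
  have := bitValue_lt x m
  cases hb : borrow x y c m <;> simp [hb] at h ⊢ <;> lia

/-! ### The program for Delegate Reachability -/

namespace DelegateReachability

open Computability (Γ')
open StackProgram StackProgram.Cmd

/-- The bits of a memory cell. In row `i` and column `j`: whether `i = j`, the reachability of `j`
from `i`, and the digits number `j` of the voting cost, the delegating cost and their difference of
voter `i`; in row `0` also the digits of the budget; in column `0` also whether voter `i` exists,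
whether it prefers casting, and whether it casts. -/
inductive Field
  | diag | edge | vote | dele | diff | bud | ex | pref | cast
  deriving DecidableEq

instance : Fintype Field :=
  ⟨{.diag, .edge, .vote, .dele, .diff, .bud, .ex, .pref, .cast}, fun f => by cases f <;> simp⟩

/-- A memory cell. -/
abbrev Cell := Field → Bool

/-- The index variables. -/
inductive Var
  | z | i | j | k | b | r
  deriving DecidableEq

instance : Fintype Var :=
  ⟨{.z, .i, .j, .k, .b, .r}, fun v => by cases v <;> simp⟩

/-- The register. -/
@[ext] structure Reg where
  st : Fin 4
  sym : Option Γ'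
  x : Bool
  y : Bool
  c : Bool
  d : Bool
  ok : Bool
  seen : Bool

noncomputable instance : Fintype Reg :=
  Fintype.ofInjective (fun r => (r.st, r.sym, r.x, r.y, r.c, r.d, r.ok, r.seen)) fun r r' h => by
    simpa [Reg.ext_iff] using h

/-- Programs over these types. -/
abbrev Program := Cmd Γ' Cell Var Reg

/-- States over these types. -/
abbrev St := State Γ' Cell Var Reg

/-- Read a cell. -/
def rd (u v : Var) (g : Reg → Cell → Reg) : Program :=
  .cell u v fun r m => (g r m, m)

/-- Write a bit of a cell. -/
def wr (u v : Var) (f : Field) (g : Reg → Cell → Bool) : Program :=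
  .cell u v fun r m => (r, Function.update m f (g r m))

/-- Change the register. -/
def op (g : Reg → Reg) : Program :=
  rd .z .z fun r _ => g r

theorem run_rd (N : ℕ) (u v : Var) (g : Reg → Cell → Reg) (s : St) :
    (rd u v g).run N s = { s with reg := g s.reg (s.mem (s.idx u) (s.idx v)) } := by
  simp [rd, run]

theorem run_op (N : ℕ) (g : Reg → Reg) (s : St) : (op g).run N s = { s with reg := g s.reg } := by
  simp [op, run_rd]

theorem run_wr (N : ℕ) (u v : Var) (f : Field) (g : Reg → Cell → Bool) (s : St) :
    (wr u v f g).run N s = { s with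
      mem := fun i j f' =>
        if i = s.idx u ∧ j = s.idx v ∧ f' = f then g s.reg (s.mem (s.idx u) (s.idx v))
        else s.mem i j f' } := by
  simp only [wr, run, State.mk.injEq, true_and]
  funext i j f'
  by_cases hi : i = s.idx u
  · subst hi
    by_cases hj : j = s.idx v
    · subst hj
      by_cases hf : f' = f
      · subst hf; simp
      · simp [hf]
    · simp [hj]
  · simp [hi]

theorem run_seq (N : ℕ) (p q : Program) (s : St) : (p.seq q).run N s = q.run N (p.run N s) :=
  rfl

/-- The register and the memory after a loop, described by an invariant. -/
theorem forEach_induction {N : ℕ} {v : Var} {p : Program} {s : St}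
    (Inv : ℕ → Reg → (ℕ → ℕ → Cell) → Prop) (h0 : Inv 0 s.reg s.mem)
    (hstep : ∀ k < N, ∀ s' : St, (∀ u, u ≠ v → p.Keeps u → s'.idx u = s.idx u) → s'.idx v = k →
      Inv k s'.reg s'.mem → Inv (k + 1) (p.run N s').reg (p.run N s').mem) :
    Inv N ((forEach v p).run N s).reg ((forEach v p).run N s).mem := by
  have key : ∀ m ≤ N, (∀ u, u ≠ v → p.Keeps u →
      ((List.range m).foldl (fun s k => p.run N (s.setIdx v k)) s).idx u = s.idx u) ∧
      Inv m ((List.range m).foldl (fun s k => p.run N (s.setIdx v k)) s).reg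
        ((List.range m).foldl (fun s k => p.run N (s.setIdx v k)) s).mem := by
    intro m
    induction m with
    | zero => exact fun _ => ⟨fun _ _ _ => rfl, h0⟩
    | succ m ih =>
      intro hm
      obtain ⟨h1, h2⟩ := ih (by lia)
      rw [List.range_succ, List.foldl_append, List.foldl_cons, List.foldl_nil]
      set s' := (List.range m).foldl (fun s k => p.run N (s.setIdx v k)) s
      have hs' : ∀ u, u ≠ v → p.Keeps u → (s'.setIdx v m).idx u = s.idx u := by
        intro u hu hk
        simpa [State.setIdx, hu] using h1 u hu hk
      exact ⟨fun u hu hk => (hk.idx_run _).trans (hs' u hu hk),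
        hstep m (by lia) _ hs' (by simp [State.setIdx]) h2⟩
  exact (key N le_rfl).2

/-- Mark the diagonal and make the edge relation reflexive. -/
def markDiagonal : Program :=
  .forEach .i ((wr .i .i .diag fun _ _ => true).seq (wr .i .i .edge fun _ _ => true))

theorem mem_markDiagonal (N : ℕ) (s : St) (i j : ℕ) (f : Field) :
    (markDiagonal.run N s).mem i j f =
      ((decide (f = .diag ∨ f = .edge) && decide (i = j ∧ i < N)) || s.mem i j f) := by
  refine forEach_induction (fun m _ mem => ∀ i j f, mem i j f =
    ((decide (f = .diag ∨ f = .edge) && decide (i = j ∧ i < m)) || s.mem i j f)) (by simp) ?_ i j f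
  intro k hk s' _ hi ih i j f
  simp only [run_seq, run_wr, hi, ih]
  by_cases h1 : i = k
  · subst h1
    by_cases h2 : i = j
    · subst h2
      cases f <;> simp
    · simp [h2, Ne.symm h2]
  · have : i < k + 1 ↔ i < k := by lia
    simp [h1, this]

/-- Compute the transitive closure of the edge relation. -/
def closure : Program :=
  .forEach .k (.forEach .i (.forEach .j ((rd .i .k fun r m => { r with x := m .edge }).seq
    ((rd .k .j fun r m => { r with y := m .edge }).seq
      (wr .i .j .edge fun r m => m .edge || (r.x && r.y))))))

/-- Subtract the delegating costs from the voting costs. -/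
def subtract : Program :=
  .forEach .i ((op fun r => { r with c := false }).seq
    ((Cmd.forEach .b ((rd .i .b fun r m => { r with
        d := diffBit (m .vote) (m .dele) r.c, c := borrowBit (m .vote) (m .dele) r.c }).seq
      (wr .i .b .diff fun r _ => r.d))).seq
    (wr .i .z .pref fun r _ => r.c)))

/-- Choose the casting voters. -/
def choose : Program :=
  .forEach .i ((rd .i .z fun r m => { r with ok := m .ex && !m .pref, seen := false }).seq
    ((Cmd.forEach .j ((rd .i .j fun r m => { r with
        x := m .edge, y := m .diag, seen := r.seen || m .diag, c := !(r.seen || m .diag) }).seq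
      ((Cmd.forEach .b ((rd .i .b fun r m => { r with d := m .diff }).seq
        (rd .j .b fun r m => { r with c := borrowBit (m .diff) r.d r.c }))).seq
      ((rd .j .i fun r m => { r with d := m .edge }).seq
      (rd .j .z fun r m => { r with
        ok := r.ok && (r.y || !r.x || (r.d && !m .pref && !r.c)) }))))).seq
    (wr .i .z .cast fun r m => r.ok || m .pref)))

/-- Subtract the costs of all voters from the budget. -/
def spend : Program :=
  (op fun r => { r with ok := true }).seq
  (.forEach .i ((rd .i .z fun r m => { r with x := m .cast, c := false }).seq
    ((Cmd.forEach .b ((rd .i .b fun r m => { r with y := if r.x then m .vote else m .dele }).seq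
      ((rd .z .b fun r m => { r with
        d := diffBit (m .bud) r.y r.c, c := borrowBit (m .bud) r.y r.c }).seq
      (wr .z .b .bud fun r _ => r.d)))).seq
    (op fun r => { r with ok := r.ok && !r.c }))))

end DelegateReachability

/-! ### Correctness of the transitive closure and of the subtraction of costs -/

namespace DelegateReachability

open Computability (Γ')
open StackProgram StackProgram.Cmd

/-- The reachability of `j` from `i` according to the memory. -/
def MemEdge (mem : ℕ → ℕ → Cell) (i j : ℕ) : Prop :=
  mem i j .edge = true

/-- Warshall's algorithm: after `m` rounds the relation is closed under composition through
intermediate vertices below `m`, and never exceeds the transitive closure. Updating in place is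
harmless, since round `k` can set an entry of row or column `k` only if it was already set. -/
theorem mem_closure (N : ℕ) (s : St) :
    (∀ i j f, f ≠ Field.edge → (closure.run N s).mem i j f = s.mem i j f) ∧
    (∀ i j, MemEdge s.mem i j → MemEdge (closure.run N s).mem i j) ∧
    (∀ i j, MemEdge (closure.run N s).mem i j → Relation.TransGen (MemEdge s.mem) i j) ∧
    ∀ k < N, ∀ i < N, ∀ j < N, MemEdge (closure.run N s).mem i k →
      MemEdge (closure.run N s).mem k j → MemEdge (closure.run N s).mem i j := by
  refine forEach_induction (fun m _ mem => (∀ i j f, f ≠ Field.edge → mem i j f = s.mem i j f) ∧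
    (∀ i j, MemEdge s.mem i j → MemEdge mem i j) ∧
    (∀ i j, MemEdge mem i j → Relation.TransGen (MemEdge s.mem) i j) ∧
    ∀ k < m, ∀ i < N, ∀ j < N, MemEdge mem i k → MemEdge mem k j → MemEdge mem i j)
    ⟨by simp, fun _ _ h => h, fun _ _ h => .single h, by simp⟩ ?_
  intro k hk s₁ _ hik ⟨ih₁, ih₂, ih₃, ih₄⟩
  -- one round adds the paths through `k`
  have round := forEach_induction (N := N) (v := .i) (s := s₁)
    (p := .forEach .j ((rd .i .k fun r m => { r with x := m .edge }).seq
      ((rd .k .j fun r m => { r with y := m .edge }).seq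
        (wr .i .j .edge fun r m => m .edge || (r.x && r.y)))))
    (fun m _ mem => (∀ i j f, f ≠ Field.edge → mem i j f = s₁.mem i j f) ∧
      (∀ i j, MemEdge s₁.mem i j → MemEdge mem i j) ∧
      (∀ i j, MemEdge mem i j → MemEdge s₁.mem i j ∨ MemEdge s₁.mem i k ∧ MemEdge s₁.mem k j) ∧
      ∀ i < m, ∀ j < N, MemEdge s₁.mem i k → MemEdge s₁.mem k j → MemEdge mem i j)
    ⟨by simp, fun _ _ h => h, fun _ _ h => .inl h, by simp⟩ ?_
  · obtain ⟨h₁, h₂, h₃, h₄⟩ := round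
    refine ⟨fun i j f hf => (h₁ i j f hf).trans (ih₁ i j f hf), fun i j h => h₂ i j (ih₂ i j h),
      fun i j h => ?_, fun k' hk' i hi j hj h h' => ?_⟩
    · rcases h₃ i j h with h | ⟨h, h'⟩
      exacts [ih₃ i j h, (ih₃ i k h).trans (ih₃ k j h')]
    · by_cases hkk : k' = k
      · subst hkk
        refine h₄ i hi j hj ?_ ?_
        · rcases h₃ i k' h with h | h
          exacts [h, h.1]
        · rcases h₃ k' j h' with h | h
          exacts [h, h.2]
      · have hlt : k' < k := by lia
        have hi' := h₃ i k' h
        have hj' := h₃ k' j h'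
        -- Each of the two edges is old or itself a detour via `k`. Two old ones compose by the
        -- earlier rounds; otherwise the composite is again a detour via `k`.
        rcases hi' with hi' | hi' <;> rcases hj' with hj' | hj'
        · exact h₂ i j (ih₄ k' hlt i hi j hj hi' hj')
        · exact h₄ i hi j hj (ih₄ k' hlt i hi k hk hi' hj'.1) hj'.2
        · exact h₄ i hi j hj hi'.1 (ih₄ k' hlt k hk j hj hi'.2 hj')
        · exact h₄ i hi j hj hi'.1 hj'.2
  · intro i hi s₂ hs₂ hii ⟨jh₁, jh₂, jh₃, jh₄⟩
    have hk₂ : s₂.idx .k = k := (hs₂ .k (by simp) (by simp [Keeps, rd, wr])).trans hik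
    have row := forEach_induction (N := N) (v := .j) (s := s₂)
      (p := (rd .i .k fun r m => { r with x := m .edge }).seq
        ((rd .k .j fun r m => { r with y := m .edge }).seq
          (wr .i .j .edge fun r m => m .edge || (r.x && r.y))))
      (fun m _ mem => (∀ i j f, f ≠ Field.edge → mem i j f = s₁.mem i j f) ∧
        (∀ i j, MemEdge s₁.mem i j → MemEdge mem i j) ∧
        (∀ i j, MemEdge mem i j →
          MemEdge s₁.mem i j ∨ MemEdge s₁.mem i k ∧ MemEdge s₁.mem k j) ∧
        (∀ i' < i, ∀ j < N, MemEdge s₁.mem i' k → MemEdge s₁.mem k j → MemEdge mem i' j) ∧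
        ∀ j < m, MemEdge s₁.mem i k → MemEdge s₁.mem k j → MemEdge mem i j)
      ⟨jh₁, jh₂, jh₃, jh₄, by simp⟩ ?_
    · obtain ⟨h₁, h₂, h₃, h₄, h₅⟩ := row
      refine ⟨h₁, h₂, h₃, fun i' hi' j hj => ?_⟩
      rcases Nat.lt_succ_iff_lt_or_eq.1 hi' with h | rfl
      exacts [h₄ i' h j hj, h₅ j hj]
    · intro j hj s₃ hs₃ hjj ⟨lh₁, lh₂, lh₃, lh₄, lh₅⟩
      have hi₃ : s₃.idx .i = i := (hs₃ .i (by simp) (by simp [Keeps, rd, wr])).trans hii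
      have hk₃ : s₃.idx .k = k := (hs₃ .k (by simp) (by simp [Keeps, rd, wr])).trans hk₂
      have old : ∀ a b, MemEdge s₃.mem a b → MemEdge
          (((rd .i .k fun r m => { r with x := m .edge }).seq
            ((rd .k .j fun r m => { r with y := m .edge }).seq
              (wr .i .j .edge fun r m => m .edge || (r.x && r.y)))).run N s₃).mem a b := by
        intro a b hab
        simp only [MemEdge, run_seq, run_rd, run_wr, hi₃, hk₃, hjj] at hab ⊢
        split_ifs with h
        · obtain ⟨rfl, rfl, _⟩ := h
          simp [hab]
        · exact hab
      have new : MemEdge s₃.mem i k → MemEdge s₃.mem k j → MemEdge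
          (((rd .i .k fun r m => { r with x := m .edge }).seq
            ((rd .k .j fun r m => { r with y := m .edge }).seq
              (wr .i .j .edge fun r m => m .edge || (r.x && r.y)))).run N s₃).mem i j := by
        intro h h'
        simp only [MemEdge, run_seq, run_rd, run_wr, hi₃, hk₃, hjj] at h h' ⊢
        simp [h, h']
      refine ⟨fun a b f hf => ?_, fun a b h => old a b (lh₂ a b h), fun a b h => ?_,
        fun i' hi' j' hj' h h' => old _ _ (lh₄ i' hi' j' hj' h h'), fun j' hj' h h' => ?_⟩
      · simp only [run_seq, run_rd, run_wr]
        rw [if_neg (fun h => hf h.2.2)]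
        exact lh₁ a b f hf
      · simp only [MemEdge, run_seq, run_rd, run_wr, hi₃, hk₃, hjj] at h
        split_ifs at h with hab
        · obtain ⟨rfl, rfl, _⟩ := hab
          simp only [Bool.or_eq_true, Bool.and_eq_true] at h
          rcases h with h | ⟨h, h'⟩
          · exact lh₃ _ _ h
          -- The bits read may have been written in this round, but entries of row or column `k`
          -- that are set now were set before it.
          · have h1 : MemEdge s₁.mem a k := by
              rcases lh₃ _ _ h with h | h
              exacts [h, h.1]
            have h2 : MemEdge s₁.mem k b := by
              rcases lh₃ _ _ h' with h | h
              exacts [h, h.2]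
            exact .inr ⟨h1, h2⟩
        · exact lh₃ _ _ h
      · rcases Nat.lt_succ_iff_lt_or_eq.1 hj' with h1 | rfl
        · exact old _ _ (lh₅ j' h1 h h')
        · exact new (lh₂ _ _ h) (lh₂ _ _ h')

/-- The number in row `i` of the memory whose digits are the bits `f`. -/
def memValue (N : ℕ) (mem : ℕ → ℕ → Cell) (f : Field) (i : ℕ) : ℕ :=
  bitValue (fun b => mem i b f) N

/-- The last borrow tells which cost is smaller. With a borrow the digits hold a wrapped difference,
so their value is claimed only when there is none. -/
theorem mem_subtract {N : ℕ} (s : St) (hz : s.idx .z = 0) :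
    (∀ i j f, f ≠ Field.diff → f ≠ Field.pref → (subtract.run N s).mem i j f = s.mem i j f) ∧
    ∀ i < N,
      (subtract.run N s).mem i 0 .pref =
        decide (memValue N s.mem .vote i < memValue N s.mem .dele i) ∧
      (memValue N s.mem .dele i ≤ memValue N s.mem .vote i →
        memValue N (subtract.run N s).mem .diff i + memValue N s.mem .dele i =
          memValue N s.mem .vote i) := by
  refine forEach_induction (fun m _ mem =>
    (∀ i j f, f ≠ Field.diff → f ≠ Field.pref → mem i j f = s.mem i j f) ∧
    ∀ i < m, mem i 0 .pref = decide (memValue N s.mem .vote i < memValue N s.mem .dele i) ∧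
      (memValue N s.mem .dele i ≤ memValue N s.mem .vote i →
        memValue N mem .diff i + memValue N s.mem .dele i = memValue N s.mem .vote i))
    ⟨by simp, by simp⟩ ?_
  intro i hi s₁ hs₁ hii ⟨ih₁, ih₂⟩
  have hz₁ : s₁.idx .z = 0 := (hs₁ .z (by simp) (by simp [Keeps, rd, wr, op])).trans hz
  simp only [run_seq, run_op]
  generalize hs₂ : ({ s₁ with reg := { s₁.reg with c := false } } : St) = s₂
  have hi₂ : s₂.idx .i = i := by subst hs₂; exact hii
  have hz₂ : s₂.idx .z = 0 := by subst hs₂; exact hz₁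
  have hm₂ : s₂.mem = s₁.mem := by subst hs₂; rfl
  have hc₂ : s₂.reg.c = false := by subst hs₂; rfl
  set x : ℕ → Bool := fun b => s.mem i b .vote with hx
  set y : ℕ → Bool := fun b => s.mem i b .dele with hy
  generalize hp : ((rd .i .b fun r m => { r with
        d := diffBit (m .vote) (m .dele) r.c, c := borrowBit (m .vote) (m .dele) r.c }).seq
      (wr .i .b .diff fun r _ => r.d) : Program) = p
  have hkp : ∀ v, p.Keeps v := by subst hp; simp [Keeps, rd, wr]
  have row := forEach_induction (N := N) (v := .b) (s := s₂) (p := p)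
    (fun m reg mem => reg.c = borrow x y false m ∧
      (∀ i' b f, ¬ (i' = i ∧ f = Field.diff) → mem i' b f = s₁.mem i' b f) ∧
      ∀ b < m, mem i b .diff = diffBit (x b) (y b) (borrow x y false b))
    ⟨hc₂, fun i' b f _ => by rw [hm₂], by simp⟩ ?_
  · obtain ⟨h₁, h₂, h₃⟩ := row
    generalize hs₄ : (forEach .b p).run N s₂ = s₄ at h₁ h₂ h₃ ⊢
    have hi₄ : s₄.idx .i = i := by
      subst hs₄
      exact (Keeps.idx_run (by simp [Keeps, hkp]) _).trans hi₂
    have hz₄ : s₄.idx .z = 0 := by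
      subst hs₄
      exact (Keeps.idx_run (by simp [Keeps, hkp]) _).trans hz₂
    simp only [run_wr, hi₄, hz₄]
    refine ⟨fun i' j f hf hf' => ?_, fun i' hi' => ?_⟩
    · rw [if_neg (by simp [hf']), h₂ i' j f (by simp [hf]), ih₁ i' j f hf hf']
    · rcases Nat.lt_succ_iff_lt_or_eq.1 hi' with hlt | rfl
      · have hne : i' ≠ i := hlt.ne
        have e : memValue N (fun i_1 j f' => if i_1 = i ∧ j = 0 ∧ f' = Field.pref then s₄.reg.c
            else s₄.mem i_1 j f') .diff i' = memValue N s₁.mem .diff i' := by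
          simp only [memValue, hne, false_and, if_false]
          exact bitValue_congr fun b _ => h₂ i' b _ (by simp [hne])
        rw [e, if_neg (by simp [hne]), h₂ i' 0 _ (by simp)]
        exact ih₂ i' hlt
      · have e : memValue N (fun i_1 j f' => if i_1 = i' ∧ j = 0 ∧ f' = Field.pref then s₄.reg.c
            else s₄.mem i_1 j f') .diff i' =
              bitValue (fun b => diffBit (x b) (y b) (borrow x y false b)) N :=
          bitValue_congr fun b hb => by simpa using h₃ b hb
        rw [e, if_pos (by simp), h₁]
        have key := bitValue_diff_add x y false N
        have hb := borrow_eq_decide x y false N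
        refine ⟨hb.trans (decide_eq_decide.2 (by simp [memValue, hx, hy])), fun hle => ?_⟩
        have hle' : bitValue y N ≤ bitValue x N := hle
        rw [hb] at key
        change _ + bitValue y N = bitValue x N
        simpa [hle'.not_gt] using key
  · intro b hb s₃ hs₃ hbb ⟨jh₁, jh₂, jh₃⟩
    have hi₃ : s₃.idx .i = i := (hs₃ .i (by simp) (hkp _)).trans hi₂
    subst hp
    have hv : s₃.mem i b .vote = x b := by
      rw [jh₂ _ _ _ (by simp), ih₁ _ _ _ (by simp) (by simp)]
    have hd : s₃.mem i b .dele = y b := by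
      rw [jh₂ _ _ _ (by simp), ih₁ _ _ _ (by simp) (by simp)]
    simp only [run_seq, run_rd, run_wr, hi₃, hbb, hv, hd, jh₁]
    refine ⟨rfl, fun i' b' f hf => ?_, fun b' hb' => ?_⟩
    · rw [if_neg (fun h => hf ⟨h.1, h.2.2⟩), jh₂ i' b' f hf]
    · rcases Nat.lt_succ_iff_lt_or_eq.1 hb' with h | rfl
      · simpa [h.ne] using jh₃ b' h
      · simp

end DelegateReachability

/-! ### Correctness of the choice of casters and of the budget check -/

namespace DelegateReachability

open Computability (Γ')
open StackProgram StackProgram.Cmd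

/-- Voter `i` does not yield to voter `j`: if it reaches `j`, then `j` reaches `i`, does not prefer
casting and is not a better casting voter, ties being broken by the index. -/
def Prevails (N : ℕ) (mem : ℕ → ℕ → Cell) (i j : ℕ) : Prop :=
  i = j ∨ ¬ MemEdge mem i j ∨ (MemEdge mem j i ∧ mem j 0 .pref = false ∧
    ¬ memValue N mem .diff j < memValue N mem .diff i + if i ≤ j then 0 else 1)

/-- The finite register cannot hold `i` and `j`; the diagonal marks reveal `i = j`, and `seen`
records whether the diagonal has been met, that is, `i ≤ j`. The differences are compared through
the borrow alone. -/
theorem mem_choose {N : ℕ} (s : St) (hz : s.idx .z = 0)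
    (hdiag : ∀ i < N, ∀ j < N, s.mem i j .diag = decide (i = j)) :
    (∀ i j f, f ≠ Field.cast → (choose.run N s).mem i j f = s.mem i j f) ∧
    ∀ i < N, ((choose.run N s).mem i 0 .cast = true ↔ s.mem i 0 .pref = true ∨
      (s.mem i 0 .ex = true ∧ s.mem i 0 .pref = false ∧ ∀ j < N, Prevails N s.mem i j)) := by
  refine forEach_induction (fun m _ mem =>
    (∀ i j f, f ≠ Field.cast → mem i j f = s.mem i j f) ∧
    ∀ i < m, (mem i 0 .cast = true ↔ s.mem i 0 .pref = true ∨
      (s.mem i 0 .ex = true ∧ s.mem i 0 .pref = false ∧ ∀ j < N, Prevails N s.mem i j)))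
    ⟨by simp, by simp⟩ ?_
  intro i hi s₁ hs₁ hii ⟨ih₁, ih₂⟩
  have hz₁ : s₁.idx .z = 0 := (hs₁ .z (by simp) (by simp [Keeps, rd, wr])).trans hz
  rw [run_seq, run_rd, run_seq]
  generalize hs₂ : ({ s₁ with reg := _ } : St) = s₂
  have hi₂ : s₂.idx .i = i := by subst hs₂; exact hii
  have hz₂ : s₂.idx .z = 0 := by subst hs₂; exact hz₁
  have hm₂ : s₂.mem = s₁.mem := by subst hs₂; rfl
  have hok₂ : s₂.reg.ok = (s.mem i 0 .ex && !s.mem i 0 .pref) := by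
    subst hs₂
    simp only [hii, hz₁]
    rw [ih₁ _ _ _ (by simp), ih₁ _ _ _ (by simp)]
  have hseen₂ : s₂.reg.seen = false := by subst hs₂; rfl
  generalize hq : (Cmd.forEach .b ((rd .i .b fun r m => { r with d := m .diff }).seq
    (rd .j .b fun r m => { r with c := borrowBit (m .diff) r.d r.c })) : Program) = q
  have hkq : ∀ v, v ≠ .b → q.Keeps v := by subst hq; simp +contextual [Keeps, rd]
  generalize hp : ((rd .i .j fun r m => { r with
        x := m .edge, y := m .diag, seen := r.seen || m .diag, c := !(r.seen || m .diag) }).seq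
      (q.seq ((rd .j .i fun r m => { r with d := m .edge }).seq
      (rd .j .z fun r m => { r with
        ok := r.ok && (r.y || !r.x || (r.d && !m .pref && !r.c)) }))) : Program) = p
  have hkp : ∀ v, v ≠ .b → p.Keeps v := by
    subst hp
    intro v hv
    exact ⟨trivial, hkq v hv, trivial, trivial⟩
  have row := forEach_induction (N := N) (v := .j) (s := s₂) (p := p)
    (fun m reg mem => mem = s₁.mem ∧ reg.seen = decide (i < m) ∧
      (reg.ok = true ↔ s.mem i 0 .ex = true ∧ s.mem i 0 .pref = false ∧
        ∀ j < m, Prevails N s.mem i j))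
    ⟨hm₂, by simp [hseen₂], by simp [hok₂]⟩ ?_
  · obtain ⟨h₁, -, h₃⟩ := row
    generalize hs₄ : (forEach .j p).run N s₂ = s₄ at h₁ h₃ ⊢
    have hi₄ : s₄.idx .i = i := by
      subst hs₄
      exact (Keeps.idx_run (show (Cmd.forEach .j p).Keeps .i from ⟨by simp, hkp _ (by simp)⟩) _).trans
        hi₂
    have hz₄ : s₄.idx .z = 0 := by
      subst hs₄
      exact (Keeps.idx_run (show (Cmd.forEach .j p).Keeps .z from ⟨by simp, hkp _ (by simp)⟩) _).trans
        hz₂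
    simp only [run_wr, hi₄, hz₄, h₁]
    refine ⟨fun i' j f hf => ?_, fun i' hi' => ?_⟩
    · rw [if_neg (by simp [hf]), ih₁ i' j f hf]
    · rcases Nat.lt_succ_iff_lt_or_eq.1 hi' with hlt | rfl
      · rw [if_neg (by simp [hlt.ne])]
        exact ih₂ i' hlt
      · rw [if_pos (by simp), Bool.or_eq_true, h₃, ih₁ _ _ _ (by simp), or_comm]
  · intro j hj s₃ hs₃ hjj ⟨jh₁, jh₂, jh₃⟩
    have hi₃ : s₃.idx .i = i := (hs₃ .i (by simp) (hkp _ (by simp))).trans hi₂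
    have hz₃ : s₃.idx .z = 0 := (hs₃ .z (by simp) (hkp _ (by simp))).trans hz₂
    have hmem : ∀ a b f, f ≠ Field.cast → s₃.mem a b f = s.mem a b f := by
      intro a b f hf
      rw [jh₁, ih₁ _ _ _ hf]
    subst hp
    rw [run_seq, run_rd, run_seq]
    generalize hs₄ : ({ s₃ with reg := _ } : St) = s₄
    have hi₄ : s₄.idx .i = i := by subst hs₄; exact hi₃
    have hj₄ : s₄.idx .j = j := by subst hs₄; exact hjj
    have hz₄ : s₄.idx .z = 0 := by subst hs₄; exact hz₃
    have hm₄ : s₄.mem = s₃.mem := by subst hs₄; rfl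
    have hok₄ : s₄.reg.ok = s₃.reg.ok := by subst hs₄; rfl
    have hx₄ : s₄.reg.x = s.mem i j .edge := by
      subst hs₄
      simp only [hi₃, hjj]
      rw [hmem _ _ _ (by simp)]
    have hy₄ : s₄.reg.y = decide (i = j) := by
      subst hs₄
      simp only [hi₃, hjj]
      rw [hmem _ _ _ (by simp), hdiag i hi j hj]
    have hseen₄ : s₄.reg.seen = decide (i < j + 1) := by
      subst hs₄
      simp only [hi₃, hjj]
      rw [hmem _ _ _ (by simp), hdiag i hi j hj, jh₂, ← Bool.decide_or]
      exact decide_eq_decide.2 Nat.lt_succ_iff_lt_or_eq.symm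
    -- The comparison starts with a borrow exactly if `j < i`. Then equal differences make `i`
    -- yield, so ties go to the smaller index.
    have hc₄ : s₄.reg.c = !decide (i < j + 1) := by
      rw [← hseen₄]
      subst hs₄
      rfl
    have cmp : (q.run N s₄).mem = s₄.mem ∧ (q.run N s₄).reg.ok = s₄.reg.ok ∧
        (q.run N s₄).reg.x = s₄.reg.x ∧ (q.run N s₄).reg.y = s₄.reg.y ∧
        (q.run N s₄).reg.seen = s₄.reg.seen ∧ (q.run N s₄).reg.c =
          borrow (fun b => s.mem j b .diff) (fun b => s.mem i b .diff) s₄.reg.c N := by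
      subst hq
      refine forEach_induction (fun m reg mem => mem = s₄.mem ∧ reg.ok = s₄.reg.ok ∧
        reg.x = s₄.reg.x ∧ reg.y = s₄.reg.y ∧ reg.seen = s₄.reg.seen ∧
        reg.c = borrow (fun b => s.mem j b .diff) (fun b => s.mem i b .diff) s₄.reg.c m)
        ⟨rfl, rfl, rfl, rfl, rfl, rfl⟩ ?_
      intro b hb s₅ hs₅ hbb ⟨k₁, k₂, k₃, k₄, k₅, k₆⟩
      have hi₅ : s₅.idx .i = i := (hs₅ .i (by simp) (by simp [Keeps, rd])).trans hi₄
      have hj₅ : s₅.idx .j = j := (hs₅ .j (by simp) (by simp [Keeps, rd])).trans hj₄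
      simp only [run_seq, run_rd, hi₅, hj₅, hbb, k₁, k₂, k₃, k₄, k₅, k₆, true_and, hm₄]
      rw [hmem _ _ _ (by simp), hmem _ _ _ (by simp)]
      rfl
    have hiq : (q.run N s₄).idx .i = i := ((hkq _ (by simp)).idx_run _).trans hi₄
    have hjq : (q.run N s₄).idx .j = j := ((hkq _ (by simp)).idx_run _).trans hj₄
    have hzq : (q.run N s₄).idx .z = 0 := ((hkq _ (by simp)).idx_run _).trans hz₄
    generalize q.run N s₄ = s₅ at cmp hiq hjq hzq
    obtain ⟨k₁, k₂, k₃, k₄, k₅, k₆⟩ := cmp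
    simp only [run_seq, run_rd, hiq, hjq, hzq, k₁, k₂, k₃, k₄, k₅, k₆, hm₄, hseen₄, hok₄, hx₄, hy₄,
      hc₄, jh₁, true_and]
    rw [borrow_eq_decide, ih₁ _ _ _ (by simp), ih₁ _ _ _ (by simp)]
    have hP : Prevails N s.mem i j ↔ (decide (i = j) || !s.mem i j .edge || (s.mem j i .edge &&
        !s.mem j 0 .pref && !decide (bitValue (fun b => s.mem j b .diff) N <
          bitValue (fun b => s.mem i b .diff) N + (!decide (i < j + 1)).toNat))) = true := by
      have e : (!decide (i < j + 1)).toNat = if i ≤ j then 0 else 1 := by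
        by_cases h : i ≤ j
        · simp [h]
        · simp [h]
      rw [e]
      simp [Prevails, MemEdge, memValue, or_assoc, and_assoc]
    rw [Bool.and_eq_true, jh₃, ← hP]
    constructor
    · rintro ⟨⟨h1, h2, h3⟩, h4⟩
      refine ⟨h1, h2, fun j' hj' => ?_⟩
      rcases Nat.lt_succ_iff_lt_or_eq.1 hj' with h | rfl
      exacts [h3 j' h, h4]
    · rintro ⟨h1, h2, h3⟩
      exact ⟨⟨h1, h2, fun j' hj' => h3 j' (by lia)⟩, h3 j (by lia)⟩

/-- The cost of voter `i` according to the memory. -/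
def memCost (N : ℕ) (mem : ℕ → ℕ → Cell) (i : ℕ) : ℕ :=
  if mem i 0 .cast = true then memValue N mem .vote i else memValue N mem .dele i

/-- Partial sums only grow, so the total fits the budget iff no single subtraction borrows. After a
borrow the stored budget is meaningless, so the invariant describes its value only while `ok` holds.
-/
theorem ok_spend {N : ℕ} (s : St) (hz : s.idx .z = 0) :
    (spend.run N s).reg.ok = true ↔
      ∑ i ∈ Finset.range N, memCost N s.mem i ≤ memValue N s.mem .bud 0 := by
  have key : ∀ s₀ : St, s₀.idx .z = 0 → s₀.mem = s.mem → s₀.reg.ok = true → _ := fun s₀ h h' h'' =>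
    forEach_induction (N := N) (v := .i) (s := s₀)
    (p := (rd .i .z fun r m => { r with x := m .cast, c := false }).seq
    ((Cmd.forEach .b ((rd .i .b fun r m => { r with y := if r.x then m .vote else m .dele }).seq
      ((rd .z .b fun r m => { r with
        d := diffBit (m .bud) r.y r.c, c := borrowBit (m .bud) r.y r.c }).seq
      (wr .z .b .bud fun r _ => r.d)))).seq
    (op fun r => { r with ok := r.ok && !r.c })))
    (fun m reg mem => (∀ i j f, f ≠ Field.bud → mem i j f = s.mem i j f) ∧
      (reg.ok = true ↔ ∑ i ∈ Finset.range m, memCost N s.mem i ≤ memValue N s.mem .bud 0) ∧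
      (reg.ok = true → memValue N mem .bud 0 + ∑ i ∈ Finset.range m, memCost N s.mem i =
        memValue N s.mem .bud 0)) ⟨by simp [h'], by simp [h''], by simp [h']⟩ ?_
  · rw [spend, run_seq, run_op]
    exact (key { s with reg := { s.reg with ok := true } } hz rfl rfl).2.1
  intro i hi s₁ hs₁ hii ⟨ih₁, ih₂, ih₃⟩
  have hz₁ : s₁.idx .z = 0 := (hs₁ .z (by simp) (by simp [Keeps, rd, wr, op])).trans h
  rw [run_seq, run_rd, run_seq, run_op]
  generalize hs₂ : ({ s₁ with reg := _ } : St) = s₂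
  have hi₂ : s₂.idx .i = i := by subst hs₂; exact hii
  have hz₂ : s₂.idx .z = 0 := by subst hs₂; exact hz₁
  have hm₂ : s₂.mem = s₁.mem := by subst hs₂; rfl
  have hok₂ : s₂.reg.ok = s₁.reg.ok := by subst hs₂; rfl
  have hc₂ : s₂.reg.c = false := by subst hs₂; rfl
  have hx₂ : s₂.reg.x = s.mem i 0 .cast := by
    subst hs₂
    simp only [hii, hz₁]
    rw [ih₁ _ _ _ (by simp)]
  set x : ℕ → Bool := fun b => s₁.mem 0 b .bud with hx
  set y : ℕ → Bool := fun b => if s.mem i 0 .cast then s.mem i b .vote else s.mem i b .dele with hy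
  have row := forEach_induction (N := N) (v := .b) (s := s₂)
    (p := (rd .i .b fun r m => { r with y := if r.x then m .vote else m .dele }).seq
      ((rd .z .b fun r m => { r with
        d := diffBit (m .bud) r.y r.c, c := borrowBit (m .bud) r.y r.c }).seq
      (wr .z .b .bud fun r _ => r.d)))
    (fun m reg mem => reg.c = borrow x y false m ∧ reg.ok = s₁.reg.ok ∧ reg.x = s.mem i 0 .cast ∧
      (∀ i' b f, f ≠ Field.bud → mem i' b f = s₁.mem i' b f) ∧
      (∀ b < m, mem 0 b .bud = diffBit (x b) (y b) (borrow x y false b)) ∧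
      -- The budget is overwritten digit by digit while it is read, so the digits still to come must
      -- be known to be untouched.
      ∀ b, m ≤ b → mem 0 b .bud = x b)
    ⟨hc₂, hok₂, hx₂, fun i' b f _ => by rw [hm₂], by simp, fun b _ => by rw [hm₂]⟩ ?_
  · obtain ⟨h₁, h₂, -, h₄, h₅, -⟩ := row
    have hval : bitValue y N = memCost N s.mem i := by
      simp only [memCost, memValue, hy]
      split_ifs <;> rfl
    have hnew : memValue N ((forEach .b ((rd .i .b fun r m => { r with
        y := if r.x then m .vote else m .dele }).seq ((rd .z .b fun r m => { r with
          d := diffBit (m .bud) r.y r.c, c := borrowBit (m .bud) r.y r.c }).seq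
        (wr .z .b .bud fun r _ => r.d)))).run N s₂).mem .bud 0 =
        bitValue (fun b => diffBit (x b) (y b) (borrow x y false b)) N :=
      bitValue_congr h₅
    have key := bitValue_diff_add x y false N
    have hb := borrow_eq_decide x y false N
    have hxv : bitValue x N = memValue N s₁.mem .bud 0 := rfl
    simp only [h₁, h₂, hnew, Finset.sum_range_succ, Bool.and_eq_true, Bool.not_eq_true']
    rw [hval, hxv] at key hb
    refine ⟨fun i' j f hf => (h₄ i' j f hf).trans (ih₁ i' j f hf), ?_, ?_⟩
    · rw [hb]
      simp only [decide_eq_false_iff_not, Bool.toNat_false, Nat.add_zero, Nat.not_lt]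
      constructor
      · rintro ⟨h1, h2⟩
        have := ih₃ h1
        lia
      · intro h1
        have h2 := ih₂.2 (by lia)
        have := ih₃ h2
        exact ⟨h2, by lia⟩
    · rintro ⟨h1, h2⟩
      have := ih₃ h1
      rw [h2] at key
      simp at key
      lia
  · intro b hb s₃ hs₃ hbb ⟨j₁, j₂, j₃, j₄, j₅, j₆⟩
    have hi₃ : s₃.idx .i = i := (hs₃ .i (by simp) (by simp [Keeps, rd, wr])).trans hi₂
    have hz₃ : s₃.idx .z = 0 := (hs₃ .z (by simp) (by simp [Keeps, rd, wr])).trans hz₂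
    have hyb : (if s₃.reg.x = true then s₃.mem i b .vote else s₃.mem i b .dele) = y b := by
      rw [j₃, j₄ _ _ _ (by simp), j₄ _ _ _ (by simp), ih₁ _ _ _ (by simp), ih₁ _ _ _ (by simp)]
    have hxb : s₃.mem 0 b .bud = x b := j₆ b le_rfl
    simp only [run_seq, run_rd, run_wr, hi₃, hz₃, hbb, hyb, hxb, j₁]
    refine ⟨rfl, j₂, j₃, fun i' b' f hf => ?_, fun b' hb' => ?_, fun b' hb' => ?_⟩
    · rw [if_neg (by simp [hf]), j₄ i' b' f hf]
    · rcases Nat.lt_succ_iff_lt_or_eq.1 hb' with h | rfl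
      · simpa [h.ne] using j₅ b' h
      · simp
    · rw [if_neg (by simp; lia), j₆ b' (by lia)]

end DelegateReachability

/-! ### Binary digits of encoded numbers -/

/-- The encoding starts with the least significant digit; past its end the default `false` agrees
with `testBit`. -/
theorem getD_encodePosNum (p : PosNum) (j : ℕ) :
    (Computability.encodePosNum p)[j]?.getD false = (p : ℕ).testBit j := by
  induction p generalizing j with
  | one => cases j <;> simp [Computability.encodePosNum, Nat.testBit_succ]
  | bit0 p ih =>
    have h : ((PosNum.bit0 p : PosNum) : ℕ) = 2 * p := by rw [PosNum.cast_bit0]; ring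
    rw [h]
    cases j with
    | zero => simp [Computability.encodePosNum]
    | succ j => simp [Computability.encodePosNum, ih, Nat.testBit_succ]
  | bit1 p ih =>
    have h : ((PosNum.bit1 p : PosNum) : ℕ) = 2 * p + 1 := by rw [PosNum.cast_bit1]; ring
    rw [h]
    cases j with
    | zero => simp [Computability.encodePosNum]
    | succ j =>
      have : (2 * (p : ℕ) + 1) / 2 = p := by lia
      simp [Computability.encodePosNum, ih, Nat.testBit_succ, this]

theorem getD_encodeNat (m j : ℕ) : (Computability.encodeNat m)[j]?.getD false = m.testBit j := by
  conv_rhs => rw [← Num.to_of_nat m]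
  unfold Computability.encodeNat Computability.encodeNum
  cases (m : Num) with
  | zero => simp
  | pos p => exact getD_encodePosNum p j

theorem lt_two_pow_length_encodeNat {m N : ℕ} (h : (Computability.encodeNat m).length ≤ N) :
    m < 2 ^ N := by
  refine Nat.lt_pow_two_of_testBit m fun j hj => ?_
  rw [← getD_encodeNat, List.getElem?_eq_none (h.trans hj)]
  rfl

namespace DelegateReachability

open Computability (Γ')
open StackProgram StackProgram.Cmd DelegateReachabilityInstance

/-! ### Reading the input -/

/-- The field to which the digits of the current part of the input belong. -/
def fieldOf (st : Fin 4) : Field :=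
  ![.bud, .vote, .dele, .edge] st

/-- The digit that is given by a symbol. -/
def digit : Option Γ' → Bool
  | some (.bit v) => v
  | _ => false

/-- Whether a symbol is a digit. -/
def isDigit : Option Γ' → Bool
  | some (.bit _) => true
  | _ => false

/-- Read a symbol of the input. -/
def parseStep : Program :=
  (Cmd.next fun r x => { r with sym := x }).seq
  (.ite (fun r => r.sym = some .bra)
    ((wr .r .z .ex fun _ _ => true).seq ((op fun r => { r with st := 1 }).seq (.zero .b)))
  (.ite (fun r => r.sym = some .comma)
    ((op fun r => { r with st := r.st + 1 }).seq (.zero .b))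
  (.ite (fun r => r.sym = some .ket)
    ((op fun r => { r with st := 0 }).seq ((Cmd.zero .b).seq (.inc .r)))
  (.ite (fun r => isDigit r.sym)
    ((Cmd.ite (fun r => r.st = 0) (wr .z .b .bud fun r _ => digit r.sym)
      (.cell .r .b fun r m => (r, Function.update m (fieldOf r.st) (digit r.sym)))).seq (.inc .b))
    (op id)))))

/-- Read the input. -/
def parse : Program :=
  .forEach .k parseStep

/-- The part of a state that matters for reading the input. -/
structure ParseState where
  st : Fin 4
  r : ℕ
  b : ℕ
  mem : ℕ → ℕ → Cell

/-- Change a bit of the memory. -/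
def setBit (mem : ℕ → ℕ → Cell) (i j : ℕ) (f : Field) (v : Bool) : ℕ → ℕ → Cell :=
  fun i' j' f' => if i' = i ∧ j' = j ∧ f' = f then v else mem i' j' f'

/-- The effect of reading a symbol. -/
def feed (N : ℕ) (p : ParseState) : Γ' → ParseState
  | .blank => p
  | .bra => { p with st := 1, b := 0, mem := setBit p.mem p.r 0 .ex true }
  | .comma => { p with st := p.st + 1, b := 0 }
  | .ket => { p with st := 0, b := 0, r := if p.r + 1 < N then p.r + 1 else p.r }
  | .bit v => { p with
      b := if p.b + 1 < N then p.b + 1 else p.b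
      mem := setBit p.mem (if p.st = 0 then 0 else p.r) p.b (fieldOf p.st) v }

/-- The part of a state that matters for reading the input. -/
def toParseState (s : St) : ParseState :=
  ⟨s.reg.st, s.idx .r, s.idx .b, s.mem⟩

theorem update_eq_setBit (mem : ℕ → ℕ → Cell) (i j : ℕ) (f : Field) (v : Bool) :
    Function.update mem i (Function.update (mem i) j (Function.update (mem i j) f v)) =
      setBit mem i j f v := by
  funext i' j' f'
  by_cases hi : i' = i
  · subst hi
    by_cases hj : j' = j
    · subst hj
      by_cases hf : f' = f
      · subst hf; simp [setBit]
      · simp [setBit, hf]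
    · simp [setBit, hj]
  · simp [setBit, hi]

/-- `take 1` also covers exhausted input: the reading loop has a fixed number of passes, and those
that find no symbol leave the parse state alone. -/
theorem parseStep_spec (N : ℕ) (s : St) (hz : s.idx .z = 0) :
    (parseStep.run N s).idx .z = 0 ∧ (parseStep.run N s).inp = s.inp.tail ∧
      toParseState (parseStep.run N s) =
        (s.inp.take 1).foldl (feed N) (toParseState s) := by
  rw [parseStep, run_seq]
  set s₁ := (Cmd.next fun (r : Reg) (x : Option Γ') => { r with sym := x }).run N s with hs₁
  have h₁ : s₁.reg.sym = s.inp.head? := rfl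
  have h₂ : toParseState s₁ = toParseState s := rfl
  have h₃ : s₁.inp = s.inp.tail := rfl
  have h₄ : s₁.idx = s.idx := rfl
  rw [← h₂, ← h₃]
  rw [← h₄] at hz
  clear_value s₁
  cases hi : s.inp with
  | nil =>
    simp only [hi, List.head?_nil] at h₁
    simp [run, h₁, isDigit, run_op, hz]
  | cons x l =>
    simp only [hi, List.head?_cons] at h₁
    cases x with
    | blank => simp [run, h₁, isDigit, run_op, hz, feed]
    | bra =>
      simp [run, wr, h₁, run_op, State.setIdx, hz, feed, toParseState, update_eq_setBit]
    | comma => simp [run, h₁, run_op, State.setIdx, hz, feed, toParseState]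
    | ket => simp [run, h₁, run_op, State.setIdx, hz, feed, toParseState]
    | bit v =>
      by_cases hst : s₁.reg.st = 0 <;>
        simp [run, wr, h₁, isDigit, hst, State.setIdx, hz, feed, toParseState, digit, fieldOf,
          update_eq_setBit]

theorem toParseState_parse {N : ℕ} (s : St) (hz : s.idx .z = 0) (hN : s.inp.length ≤ N) :
    toParseState (parse.run N s) = s.inp.foldl (feed N) (toParseState s) ∧
      (parse.run N s).idx .z = 0 := by
  have key : ∀ m, let s' := (List.range m).foldl (fun s k => parseStep.run N (s.setIdx .k k)) s
      s'.idx .z = 0 ∧ s'.inp = s.inp.drop m ∧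
      toParseState s' = (s.inp.take m).foldl (feed N) (toParseState s) := by
    intro m
    induction m with
    | zero => simp [hz]
    | succ m ih =>
      rw [List.range_succ, List.foldl_append, List.foldl_cons, List.foldl_nil]
      obtain ⟨h₁, h₂, h₃⟩ := ih
      set s' := (List.range m).foldl (fun s k => parseStep.run N (s.setIdx .k k)) s
      obtain ⟨k₁, k₂, k₃⟩ := parseStep_spec N (s'.setIdx .k m) (by simpa [State.setIdx] using h₁)
      refine ⟨k₁, ?_, ?_⟩
      · rw [k₂, show (s'.setIdx .k m).inp = s.inp.drop m from h₂, List.tail_drop]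
      · rw [k₃, show (s'.setIdx .k m).inp = s.inp.drop m from h₂,
          show toParseState (s'.setIdx .k m) = toParseState s' by simp [toParseState, State.setIdx],
          h₃, ← List.foldl_append, List.take_add]
  obtain ⟨h₁, -, h₃⟩ := key N
  rw [List.take_of_length_le hN] at h₃
  refine ⟨?_, ?_⟩
  · rw [← h₃]
    simp [parse, run, toParseState, State.setIdx]
  · simpa [parse, run, State.setIdx] using h₁

/-- The hypothesis keeps the position from saturating, so each digit gets its own column. -/
theorem foldl_feed_bits {N : ℕ} (l : List Bool) (p : ParseState) (h : p.b + l.length < N) :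
    (l.map Γ'.bit).foldl (feed N) p =
      { p with
        b := p.b + l.length
        mem := fun i j f => if i = (if p.st = 0 then 0 else p.r) ∧ f = fieldOf p.st ∧ p.b ≤ j then
          l[j - p.b]?.getD (p.mem i j f) else p.mem i j f } := by
  induction l generalizing p with
  | nil => simp
  | cons v l ih =>
    simp only [List.length_cons] at h
    rw [List.map_cons, List.foldl_cons, ih _ (by simp only [feed]; split_ifs <;> lia)]
    have hb : p.b + 1 < N := by lia
    simp only [feed, hb, if_true, List.length_cons, ParseState.mk.injEq, true_and]
    refine ⟨by lia, ?_⟩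
    funext i j f
    by_cases hi : i = (if p.st = 0 then 0 else p.r) ∧ f = fieldOf p.st
    · obtain ⟨hi, hf⟩ := hi
      rcases lt_trichotomy j p.b with hj | hj | hj
      · have h1 : ¬ p.b + 1 ≤ j := by lia
        have h2 : ¬ p.b ≤ j := by lia
        simp [setBit, h1, h2, hj.ne]
      · subst hj
        simp [setBit, hi, hf]
      · obtain ⟨k, rfl⟩ : ∃ k, j = p.b + 1 + k := ⟨j - (p.b + 1), by lia⟩
        have h1 : p.b + 1 + k - p.b = k + 1 := by lia
        have h2 : p.b + 1 + k ≠ p.b := by lia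
        have h3 : p.b ≤ p.b + 1 + k := by lia
        simp [setBit, hi, hf, h1, h2, h3]
    · have h1 : ¬ (i = (if p.st = 0 then 0 else p.r) ∧ f = fieldOf p.st ∧ p.b + 1 ≤ j) :=
        fun h => hi ⟨h.1, h.2.1⟩
      have h2 : ¬ (i = (if p.st = 0 then 0 else p.r) ∧ f = fieldOf p.st ∧ p.b ≤ j) :=
        fun h => hi ⟨h.1, h.2.1⟩
      have h3 : ¬ (i = (if p.st = 0 then 0 else p.r) ∧ j = p.b ∧ f = fieldOf p.st) :=
        fun h => hi ⟨h.1, h.2.2⟩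
      rw [if_neg h1, if_neg h2, setBit, if_neg h3]

/-- The bits in the row of a voter after reading the input. -/
def voterBit (I : CLDElection) (i : Fin I.n) (j : ℕ) : Cell
  | .ex => decide (j = 0)
  | .vote => (I.votingCost i).testBit j
  | .dele => (I.delegatingCost i).testBit j
  | .edge => if h : j < I.n then decide ((i, ⟨j, h⟩) ∈ I.edges) else false
  | _ => false

/-- The memory after reading the records of the first `k` voters. -/
def voterMem (I : CLDElection) (k : ℕ) : ℕ → ℕ → Cell :=
  fun i j f => if h : i < I.n then decide (i < k) && voterBit I ⟨i, h⟩ j f else false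

theorem encodeNumber_eq (m : ℕ) : encodeNumber m = (Computability.encodeNat m).map Γ'.bit :=
  rfl

/-- The state runs through `0, 1, 2, 3, 0`, which directs the digits to the voting cost, the
delegating cost and the adjacency row. The opening `bra` resets the position, so `b` is arbitrary.
-/
theorem foldl_feed_encodeVoter {N : ℕ} (I : CLDElection) (i : Fin I.n) (b : ℕ) (hn : I.n < N)
    (hv : (Computability.encodeNat (I.votingCost i)).length < N)
    (hd : (Computability.encodeNat (I.delegatingCost i)).length < N) :
    (encodeVoter I i).foldl (feed N) ⟨0, i, b, voterMem I i⟩ =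
      ⟨0, i + 1, 0, voterMem I (i + 1)⟩ := by
  have hrow : (List.finRange I.n).map (fun j => Γ'.bit (decide ((i, j) ∈ I.edges))) =
      ((List.finRange I.n).map fun j => decide ((i, j) ∈ I.edges)).map Γ'.bit := by
    rw [List.map_map]; rfl
  rw [encodeVoter, encodeNumber_eq, encodeNumber_eq, hrow]
  simp only [List.foldl_append, List.foldl_cons, List.foldl_nil, feed]
  rw [foldl_feed_bits (Computability.encodeNat (I.votingCost i)) _ (by simpa using hv),
    foldl_feed_bits (Computability.encodeNat (I.delegatingCost i)) _ (by simpa using hd),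
    foldl_feed_bits (List.map _ _) _ (by simpa using hn)]
  have hi : (i : ℕ) + 1 < N := by have := i.2; lia
  simp only [hi, if_true, ParseState.mk.injEq, true_and]
  funext i' j f
  by_cases hii : i' = i
  · subst hii
    cases f <;> simp [voterMem, fieldOf, setBit, voterBit, getD_encodeNat]
    by_cases hj : j < I.n <;> simp [hj]
  · have h1 : i' < (i : ℕ) + 1 ↔ i' < i := by lia
    simp [hii, setBit, voterMem, h1]

theorem foldl_feed_voters {N : ℕ} (I : CLDElection) (hn : I.n < N)
    (hv : ∀ i, (Computability.encodeNat (I.votingCost i)).length < N)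
    (hd : ∀ i, (Computability.encodeNat (I.delegatingCost i)).length < N) :
    ((List.finRange I.n).flatMap (encodeVoter I)).foldl (feed N) ⟨0, 0, 0, fun _ _ _ => false⟩ =
      ⟨0, I.n, 0, voterMem I I.n⟩ := by
  have key : ∀ k ≤ I.n, (((List.finRange I.n).take k).flatMap (encodeVoter I)).foldl (feed N)
      ⟨0, 0, 0, fun _ _ _ => false⟩ = ⟨0, k, 0, voterMem I k⟩ := by
    intro k
    induction k with
    | zero =>
      intro _
      simp only [List.take_zero, List.flatMap_nil, List.foldl_nil, ParseState.mk.injEq, true_and]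
      funext i j f
      simp [voterMem]
    | succ k ih =>
      intro hk
      rw [List.take_succ_eq_append_getElem (by simpa using hk), List.flatMap_append,
        List.foldl_append, ih (by lia), List.flatMap_singleton]
      simpa using foldl_feed_encodeVoter I ⟨k, hk⟩ 0 hn (hv _) (hd _)
  have := key I.n le_rfl
  rwa [List.take_of_length_le (by simp)] at this

/-- The memory after reading an instance. -/
def inputMem (P : DelegateReachabilityInstance) : ℕ → ℕ → Cell :=
  fun i j f => if f = .bud then decide (i = 0) && (P.budget : ℕ).testBit j
    else voterMem P.election P.election.n i j f

theorem length_encodeVoter_le (P : DelegateReachabilityInstance) (i : Fin P.election.n) :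
    (encodeVoter P.election i).length ≤ (encode P).length := by
  obtain ⟨l, l', h⟩ := List.append_of_mem (List.mem_finRange i)
  simp only [encode, h, List.flatMap_append, List.flatMap_cons, List.length_append]
  lia

theorem length_votingCost_le (P : DelegateReachabilityInstance) (i : Fin P.election.n) :
    (Computability.encodeNat (P.election.votingCost i)).length ≤ (encode P).length := by
  refine le_trans ?_ (length_encodeVoter_le P i)
  simp only [encodeVoter, encodeNumber_eq, List.length_append, List.length_map]
  lia

theorem length_delegatingCost_le (P : DelegateReachabilityInstance) (i : Fin P.election.n) :
    (Computability.encodeNat (P.election.delegatingCost i)).length ≤ (encode P).length := by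
  refine le_trans ?_ (length_encodeVoter_le P i)
  simp only [encodeVoter, encodeNumber_eq, List.length_append, List.length_map]
  lia

theorem length_budget_le (P : DelegateReachabilityInstance) :
    (Computability.encodeNat P.budget).length ≤ (encode P).length := by
  simp [encode, encodeNumber_eq]

theorem n_le_length (P : DelegateReachabilityInstance) : P.election.n ≤ (encode P).length := by
  rcases Nat.eq_zero_or_pos P.election.n with h | h
  · lia
  · refine le_trans ?_ (length_encodeVoter_le P ⟨0, h⟩)
    simp only [encodeVoter, List.length_append, List.length_map, List.length_finRange]
    lia

/-- After the last voter the state is `0`, so the trailing digits land in the budget field of row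
`0`. As `N` exceeds the input length, no position or row saturates. -/
theorem mem_parse (P : DelegateReachabilityInstance) (r : Reg) (hr : r.st = 0) :
    (parse.run ((encode P).length + 1) (State.init r (encode P))).mem = inputMem P ∧
      (parse.run ((encode P).length + 1) (State.init r (encode P))).idx .z = 0 := by
  set N := (encode P).length + 1 with hN
  obtain ⟨h₁, h₂⟩ := toParseState_parse (N := N) (State.init r (encode P)) rfl
    (show (encode P).length ≤ N by lia)
  refine ⟨?_, h₂⟩
  have h₃ := congrArg ParseState.mem h₁
  have hs : toParseState (State.init r (encode P)) = ⟨0, 0, 0, fun _ _ _ => false⟩ := by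
    simp only [toParseState, State.init, hr]
    rfl
  have hi : (State.init (C := Var) (Cell := Cell) r (encode P)).inp =
    (List.finRange P.election.n).flatMap (encodeVoter P.election) ++
      (Computability.encodeNat P.budget).map Γ'.bit := rfl
  rw [hs, hi, List.foldl_append, foldl_feed_voters P.election
    (Nat.lt_succ_of_le (n_le_length P)) (fun i => Nat.lt_succ_of_le (length_votingCost_le P i))
    (fun i => Nat.lt_succ_of_le (length_delegatingCost_le P i)),
    foldl_feed_bits _ _ (by rw [Nat.zero_add]; exact Nat.lt_succ_of_le (length_budget_le P))] at h₃
  refine h₃.trans ?_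
  funext i j f
  have hb : ∀ i j, voterMem P.election P.election.n i j .bud = false := fun i j => by
    simp [voterMem, voterBit]
  by_cases hf : f = .bud
  · subst hf
    by_cases hi : i = 0 <;> simp [hi, fieldOf, inputMem, hb, getD_encodeNat]
  · simp [hf, fieldOf, inputMem]

end DelegateReachability

/-! ### The greedy choice of casting voters -/

namespace CLDElection

variable {I : CLDElection}

theorem mem_component {i j : Fin I.n} : j ∈ I.component i ↔ I.Reaches i j ∧ I.Reaches j i := by
  simp [component]

theorem self_mem_component (i : Fin I.n) : i ∈ I.component i :=
  mem_component.2 ⟨.refl, .refl⟩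

theorem component_eq_of_mem {i j : Fin I.n} (h : j ∈ I.component i) :
    I.component j = I.component i := by
  obtain ⟨h, h'⟩ := mem_component.1 h
  ext k
  simp only [mem_component]
  exact ⟨fun ⟨a, b⟩ => ⟨h.trans a, b.trans h'⟩, fun ⟨a, b⟩ => ⟨h'.trans a, b.trans h⟩⟩

theorem IsSinkComponent.component_eq {S : Finset (Fin I.n)} (h : I.IsSinkComponent S)
    {i : Fin I.n} (hi : i ∈ S) : I.component i = S := by
  obtain ⟨j, rfl⟩ := h.1
  exact component_eq_of_mem hi

theorem IsSinkComponent.reaches {S : Finset (Fin I.n)} (h : I.IsSinkComponent S) {i j : Fin I.n}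
    (hi : i ∈ S) (hj : j ∈ S) : I.Reaches i j := by
  rw [← h.component_eq hi] at hj
  exact (mem_component.1 hj).1

theorem IsSinkComponent.mem_of_reaches {S : Finset (Fin I.n)} (h : I.IsSinkComponent S)
    {i j : Fin I.n} (hi : i ∈ S) (hij : I.Reaches i j) : j ∈ S := by
  induction hij with
  | refl => exact hi
  | tail _ hbc ih => exact h.2 _ hbc ih

/-- Among the voters reachable from `i`, take `j` with the fewest reachable voters. The end of an
edge that starts in its component reaches no more than `j` does, hence by minimality just as much,
in particular `j` itself. -/
theorem exists_reaches_sink (i : Fin I.n) :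
    ∃ j, I.Reaches i j ∧ I.IsSinkComponent (I.component j) := by
  classical
  obtain ⟨j, hj, hmin⟩ := Finset.exists_min_image (Finset.univ.filter (I.Reaches i))
    (fun j => (Finset.univ.filter (I.Reaches j)).card) ⟨i, by simpa using .refl⟩
  simp only [Finset.mem_filter, Finset.mem_univ, true_and] at hj hmin
  refine ⟨j, hj, ⟨j, rfl⟩, fun e he hej => ?_⟩
  have hjb : I.Reaches j e.2 := (mem_component.1 hej).1.tail he
  have heq := Finset.eq_of_subset_of_card_le (s := Finset.univ.filter (I.Reaches e.2))
    (t := Finset.univ.filter (I.Reaches j)) (fun k hk => by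
      simp only [Finset.mem_filter, Finset.mem_univ, true_and] at hk ⊢
      exact hjb.trans hk) (hmin _ (hj.trans hjb))
  have : j ∈ Finset.univ.filter (I.Reaches e.2) := by
    rw [heq]
    simpa using .refl
  exact mem_component.2 ⟨hjb, by simpa using this⟩

theorem IsGreedy.exists_reaches {C : Finset (Fin I.n)} (h : I.IsGreedy C) (i : Fin I.n) :
    ∃ c ∈ C, I.Reaches i c := by
  obtain ⟨j, hij, hS⟩ := exists_reaches_sink i
  by_cases hp : ∃ k ∈ I.component j, I.PrefersCasting k
  · obtain ⟨k, hk, hkp⟩ := hp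
    exact ⟨k, h.prefersCasting_mem k hkp, hij.trans (mem_component.1 hk).1⟩
  · push Not at hp
    obtain ⟨k, hk, hCk, -⟩ := h.sink _ hS hp
    have : k ∈ C ∩ I.component j := by simp [hCk]
    exact ⟨k, (Finset.mem_inter.1 this).1, hij.trans (mem_component.1 hk).1⟩

/-- Every voter outside `C` delegates to a neighbour that is closer to `C`; following these edges
strictly decreases the distance and so ends in `C`. -/
theorem exists_solution_of_reaches {C : Finset (Fin I.n)} (h : ∀ i, ∃ c ∈ C, I.Reaches i c) :
    ∃ D, I.IsSolution C D ∧ I.ReachesCasters C D := by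
  classical
  -- `W n i` says that some walk of length `n` leads from `i` into `C`; `rank` below is the least
  -- such `n`.
  let W : ℕ → Fin I.n → Prop := fun n =>
    Nat.rec (motive := fun _ => Fin I.n → Prop) (· ∈ C) (fun _ P i => ∃ j, (i, j) ∈ I.edges ∧ P j) n
  have hW : ∀ i, ∃ n, W n i := by
    intro i
    obtain ⟨c, hc, hic⟩ := h i
    induction hic using Relation.ReflTransGen.head_induction_on with
    | refl => exact ⟨0, hc⟩
    | head hab _ ih =>
      obtain ⟨n, hn⟩ := ih
      exact ⟨n + 1, _, hab, hn⟩
  let rank : Fin I.n → ℕ := fun i => Nat.find (hW i)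
  have hnext : ∀ i, ∃ j, i ∉ C → (i, j) ∈ I.edges ∧ rank j < rank i := by
    intro i
    by_cases hi : i ∈ C
    · exact ⟨i, fun h => absurd hi h⟩
    · have hs := Nat.find_spec (hW i)
      cases hn : Nat.find (hW i) with
      | zero => rw [hn] at hs; exact absurd hs hi
      | succ n =>
        rw [hn] at hs
        obtain ⟨j, hij, hj⟩ := hs
        refine ⟨j, fun _ => ⟨hij, ?_⟩⟩
        have := Nat.find_min' (hW j) hj
        simp only [rank]
        lia
  choose next hnext using hnext
  have hD : ∀ a b, (a, b) ∈ Cᶜ.image (fun i => (i, next i)) ↔ a ∉ C ∧ next a = b := by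
    intro a b
    simp only [Finset.mem_image, Finset.mem_compl, Prod.mk.injEq]
    exact ⟨by rintro ⟨i, hi, rfl, rfl⟩; exact ⟨hi, rfl⟩, fun ⟨ha, hb⟩ => ⟨a, ha, rfl, hb⟩⟩
  refine ⟨Cᶜ.image (fun i => (i, next i)), ⟨?_, ?_, ?_⟩, ?_⟩
  · rintro ⟨a, b⟩ he
    obtain ⟨ha, rfl⟩ := (hD a b).1 he
    exact (hnext a ha).1
  · rintro ⟨a, b⟩ he
    exact ((hD a b).1 he).1
  · exact fun i hi => ⟨next i, (hD _ _).2 ⟨hi, rfl⟩, fun j hj => ((hD _ _).1 hj).2.symm⟩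
  · suffices ∀ n i, rank i = n → i ∉ C → ∃ c ∈ C, Relation.ReflTransGen
        (fun a b => (a, b) ∈ Cᶜ.image (fun i => (i, next i))) i c from fun i hi => this _ i rfl hi
    intro n
    induction n using Nat.strong_induction_on with
    | _ n ih =>
      rintro i rfl hi
      have hstep : (i, next i) ∈ Cᶜ.image (fun i => (i, next i)) := (hD _ _).2 ⟨hi, rfl⟩
      by_cases hn : next i ∈ C
      · exact ⟨next i, hn, .single hstep⟩
      · obtain ⟨c, hc, hr⟩ := ih _ (hnext i hi).2 (next i) rfl hn
        exact ⟨c, hc, .head hstep hr⟩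

theorem exists_reaches_of_solution {C : Finset (Fin I.n)} {D : Finset (Fin I.n × Fin I.n)}
    (h : I.IsSolution C D) (hr : I.ReachesCasters C D) (i : Fin I.n) : ∃ c ∈ C, I.Reaches i c := by
  by_cases hi : i ∈ C
  · exact ⟨i, hi, .refl⟩
  · obtain ⟨c, hc, hic⟩ := hr i hi
    exact ⟨c, hc, hic.lift id fun a b hab => h.subset_edges hab⟩

/-- The cost that a voter incurs. -/
def voterCost (I : CLDElection) (C : Finset (Fin I.n)) (i : Fin I.n) : ℕ :=
  if i ∈ C then I.votingCost i else I.delegatingCost i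

theorem cost_eq_sum (C : Finset (Fin I.n)) : I.cost C = ∑ i, I.voterCost C i := by
  rw [cost, ← Finset.sum_add_sum_compl C (I.voterCost C)]
  congr 1
  · exact Finset.sum_congr rfl fun i hi => by simp [voterCost, hi]
  · exact Finset.sum_congr rfl fun i hi => by simp [voterCost, Finset.mem_compl.1 hi]

/-- If the component is a sink without voters who prefer casting, `C'` has a caster `c` in it, and
the sole caster of `C` is at least as cheap as `c` alone. Otherwise `C` casts exactly where casting
is strictly cheaper, which is best voter by voter. -/
theorem IsGreedy.sum_component_le {C C' : Finset (Fin I.n)} (h : I.IsGreedy C)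
    (h' : ∀ i, ∃ c ∈ C', I.Reaches i c) (i : Fin I.n) :
    ∑ j ∈ I.component i, I.voterCost C j ≤ ∑ j ∈ I.component i, I.voterCost C' j := by
  set S := I.component i with hSi
  by_cases hS : I.IsSinkComponent S ∧ ∀ j ∈ S, ¬ I.PrefersCasting j
  · obtain ⟨hS, hp⟩ := hS
    obtain ⟨m, hm, hCm, hmin⟩ := h.sink S hS hp
    obtain ⟨c, hc, hic⟩ := h' i
    have hcS : c ∈ S := hS.mem_of_reaches (self_mem_component i) hic
    have hmC : m ∈ C := (Finset.mem_inter.1 (by simp [hCm] : m ∈ C ∩ S)).1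
    have e₁ : ∑ j ∈ S, I.voterCost C j = I.soleCasterCost S m := by
      rw [← Finset.add_sum_erase S _ hm, soleCasterCost]
      congr 1
      · simp [voterCost, hmC]
      · refine Finset.sum_congr rfl fun j hj => ?_
        have : j ∉ C := fun hjC => by
          have hj' : j ∈ C ∩ S := Finset.mem_inter.2 ⟨hjC, Finset.mem_of_mem_erase hj⟩
          rw [hCm, Finset.mem_singleton] at hj'
          exact Finset.ne_of_mem_erase hj hj'
        simp [voterCost, this]
    -- Nobody in `S` prefers casting, so further casters of `C'` pay at least their delegating cost.
    have e₂ : I.soleCasterCost S c ≤ ∑ j ∈ S, I.voterCost C' j := by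
      rw [← Finset.add_sum_erase S _ hcS, soleCasterCost]
      refine Nat.add_le_add (by simp [voterCost, hc]) (Finset.sum_le_sum fun j hj => ?_)
      have := hp j (Finset.mem_of_mem_erase hj)
      simp only [PrefersCasting, not_lt] at this
      unfold voterCost
      split_ifs <;> lia
    rw [e₁]
    exact (hmin c hcS).trans e₂
  · refine Finset.sum_le_sum fun j hj => ?_
    have hj' : j ∈ C ↔ I.PrefersCasting j := by
      refine ⟨fun hjC => ?_, h.prefersCasting_mem j⟩
      rcases h.mem_only j hjC with hp | ⟨T, hT, hjT, hp⟩
      · exact hp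
      · have : T = S := by rw [← hT.component_eq hjT, hSi, component_eq_of_mem hj]
        subst this
        exact absurd ⟨hT, hp⟩ hS
    unfold voterCost
    simp only [hj', PrefersCasting]
    split_ifs <;> lia

theorem IsGreedy.cost_le {C C' : Finset (Fin I.n)} (h : I.IsGreedy C)
    (h' : ∀ i, ∃ c ∈ C', I.Reaches i c) : I.cost C ≤ I.cost C' := by
  classical
  have hsum : ∀ f : Fin I.n → ℕ, ∑ i, f i =
      ∑ S ∈ Finset.univ.image I.component, ∑ j ∈ S, f j := by
    intro f
    rw [← Finset.sum_fiberwise_of_maps_to (g := I.component) (t := Finset.univ.image I.component)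
      fun i _ => Finset.mem_image_of_mem _ (Finset.mem_univ i)]
    refine Finset.sum_congr rfl fun S hS => Finset.sum_congr ?_ fun _ _ => rfl
    obtain ⟨i, -, rfl⟩ := Finset.mem_image.1 hS
    ext j
    simp only [Finset.mem_filter, Finset.mem_univ, true_and]
    exact ⟨fun hj => hj ▸ self_mem_component j, component_eq_of_mem⟩
  rw [cost_eq_sum, cost_eq_sum, hsum, hsum]
  refine Finset.sum_le_sum fun S hS => ?_
  obtain ⟨i, -, rfl⟩ := Finset.mem_image.1 hS
  exact h.sum_component_le h' i

/-- The additional cost of a casting ballot. -/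
def extraCost (I : CLDElection) (i : Fin I.n) : ℕ :=
  I.votingCost i - I.delegatingCost i

/-- Voter `i` is a cheaper casting voter than `j`, ties being broken by the index. -/
def Beats (I : CLDElection) (i j : Fin I.n) : Prop :=
  I.extraCost i + (if i ≤ j then 0 else 1) ≤ I.extraCost j

/-- Voter `i` is the cheapest casting voter of a sink component in which nobody prefers casting. -/
def IsSoleCaster (I : CLDElection) (i : Fin I.n) : Prop :=
  ¬ I.PrefersCasting i ∧ ∀ j, j ≠ i → I.Reaches i j →
    I.Reaches j i ∧ ¬ I.PrefersCasting j ∧ I.Beats i j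

open Classical in
/-- A greedy set of casting voters. -/
noncomputable def greedySet (I : CLDElection) : Finset (Fin I.n) :=
  Finset.univ.filter fun i => I.PrefersCasting i ∨ I.IsSoleCaster i

theorem mem_greedySet {i : Fin I.n} :
    i ∈ I.greedySet ↔ I.PrefersCasting i ∨ I.IsSoleCaster i := by
  simp [greedySet]

/-- The second summand does not depend on `i`, so a cheapest sole caster is one of least
`extraCost`. Since `i` does not prefer casting, the subtraction in `extraCost` does not truncate. -/
theorem soleCasterCost_eq {S : Finset (Fin I.n)} {i : Fin I.n} (hi : i ∈ S)
    (hp : ¬ I.PrefersCasting i) :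
    I.soleCasterCost S i = I.extraCost i + ∑ j ∈ S, I.delegatingCost j := by
  simp only [PrefersCasting, not_lt] at hp
  rw [← Finset.add_sum_erase S _ hi, soleCasterCost, extraCost]
  lia

theorem isGreedy_greedySet (I : CLDElection) : I.IsGreedy I.greedySet where
  prefersCasting_mem i hi := mem_greedySet.2 (.inl hi)
  sink S hS hp := by
    obtain ⟨i₀, rfl⟩ := hS.1
    -- The lexicographic minimum makes the caster unique and matches the tie-breaking in `Beats`.
    obtain ⟨i, hi, hmin⟩ := Finset.exists_min_image (I.component i₀)
      (fun i => toLex (I.extraCost i, i)) ⟨i₀, self_mem_component i₀⟩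
    have hbeats : ∀ j ∈ I.component i₀, I.Beats i j := by
      intro j hj
      have := hmin j hj
      rw [Prod.Lex.toLex_le_toLex] at this
      unfold Beats
      rcases this with h | ⟨h, h'⟩
      · split_ifs <;> lia
      · simp only at h h'
        simp [h', h]
    refine ⟨i, hi, ?_, fun j hj => ?_⟩
    · ext k
      simp only [Finset.mem_inter, Finset.mem_singleton, mem_greedySet]
      constructor
      · rintro ⟨hk | hk, hkS⟩
        · exact absurd hk (hp k hkS)
        -- Two distinct voters cannot beat each other.
        · by_contra hne
          have h1 := (hk.2 i (Ne.symm hne) (hS.reaches hkS hi)).2.2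
          have h2 := hbeats k hkS
          unfold Beats at h1 h2
          have : i ≤ k ∨ k ≤ i := le_total i k
          have h3 : i ≤ k → k ≤ i → False := fun a b => hne (le_antisymm b a)
          split_ifs at h1 h2 <;> lia
      · rintro rfl
        exact ⟨.inr ⟨hp k hi, fun j _ hj => ⟨hS.reaches (hS.mem_of_reaches hi hj) hi,
          hp j (hS.mem_of_reaches hi hj), hbeats j (hS.mem_of_reaches hi hj)⟩⟩, hi⟩
    · rw [soleCasterCost_eq hi (hp i hi), soleCasterCost_eq hj (hp j hj)]
      have := hbeats j hj
      unfold Beats at this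
      lia
  mem_only i hi := by
    rcases mem_greedySet.1 hi with h | h
    · exact .inl h
    -- Everything reachable from a sole caster reaches back, so no edge leaves its component.
    · refine .inr ⟨I.component i, ⟨⟨i, rfl⟩, fun e he hei => ?_⟩, self_mem_component i,
        fun j hj => ?_⟩
      · have hib := (mem_component.1 hei).1.tail he
        by_cases hb : e.2 = i
        · rw [hb]; exact self_mem_component i
        · exact mem_component.2 ⟨hib, (h.2 _ hb hib).1⟩
      · by_cases hji : j = i
        · rw [hji]; exact h.1
        · exact (h.2 j hji (mem_component.1 hj).1).2.1

end CLDElection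

theorem DelegateReachabilityInstance.isYes_iff (P : DelegateReachabilityInstance) :
    P.IsYes ↔ P.election.cost P.election.greedySet ≤ P.budget := by
  have hg := P.election.isGreedy_greedySet
  constructor
  · rintro ⟨C, D, hs, hc, hr⟩
    exact (hg.cost_le (CLDElection.exists_reaches_of_solution hs hr)).trans hc
  · intro h
    obtain ⟨D, hs, hr⟩ := CLDElection.exists_solution_of_reaches hg.exists_reaches
    exact ⟨_, D, hs, h, hr⟩

/-! ### Correctness of the decision program -/

namespace DelegateReachability

open Computability (Γ')
open StackProgram StackProgram.Cmd DelegateReachabilityInstance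

/-- The program that decides Delegate Reachability. -/
def decisionProgram : Program :=
  parse.seq (markDiagonal.seq (closure.seq (subtract.seq (choose.seq spend))))

/-- The initial register. -/
def initReg : Reg :=
  ⟨0, none, false, false, false, false, false, false⟩

theorem wellFormed_decisionProgram : decisionProgram.WellFormed := by
  simp [decisionProgram, parse, parseStep, markDiagonal, closure, subtract, choose, spend,
    WellFormed, Keeps, rd, wr, op]

theorem memValue_vote (P : DelegateReachabilityInstance) (i : Fin P.election.n) :
    memValue ((encode P).length + 1) (inputMem P) .vote i = P.election.votingCost i := by
  have h : (fun b => inputMem P i b .vote) = (P.election.votingCost i).testBit := by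
    funext b
    simp [inputMem, voterMem, voterBit]
  rw [memValue, h, bitValue_testBit]
  exact Nat.mod_eq_of_lt (lt_two_pow_length_encodeNat ((length_votingCost_le P i).trans (by lia)))

theorem memValue_dele (P : DelegateReachabilityInstance) (i : Fin P.election.n) :
    memValue ((encode P).length + 1) (inputMem P) .dele i = P.election.delegatingCost i := by
  have h : (fun b => inputMem P i b .dele) = (P.election.delegatingCost i).testBit := by
    funext b
    simp [inputMem, voterMem, voterBit]
  rw [memValue, h, bitValue_testBit]
  exact Nat.mod_eq_of_lt
    (lt_two_pow_length_encodeNat ((length_delegatingCost_le P i).trans (by lia)))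

theorem memValue_bud (P : DelegateReachabilityInstance) :
    memValue ((encode P).length + 1) (inputMem P) .bud 0 = P.budget := by
  have h : (fun b => inputMem P 0 b .bud) = (P.budget : ℕ).testBit := by
    funext b
    simp [inputMem]
  rw [memValue, h, bitValue_testBit]
  exact Nat.mod_eq_of_lt (lt_two_pow_length_encodeNat ((length_budget_le P).trans (by lia)))

theorem memValue_of_le (P : DelegateReachabilityInstance) (N : ℕ) {i : ℕ} (hi : P.election.n ≤ i)
    {f : Field} (hf : f ≠ .bud) : memValue N (inputMem P) f i = 0 := by
  have h : ∀ b, inputMem P i b f = false := fun b => by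
    simp [inputMem, hf, voterMem, hi.not_gt]
  simp [memValue, bitValue, h]

theorem memValue_congr {N : ℕ} {mem mem' : ℕ → ℕ → Cell} {f : Field} {i : ℕ}
    (h : ∀ b, mem i b f = mem' i b f) : memValue N mem f i = memValue N mem' f i :=
  bitValue_congr fun b _ => h b

/-- The memory after the closure stage represents reachability. -/
theorem memEdge_closure (P : DelegateReachabilityInstance) {N : ℕ} (hN : P.election.n < N) (s : St)
    (hs : s.mem = inputMem P) :
    (∀ i j : Fin P.election.n, MemEdge (closure.run N (markDiagonal.run N s)).mem i j ↔
      P.election.Reaches i j) ∧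
    ∀ (i : Fin P.election.n) (j : ℕ), MemEdge (closure.run N (markDiagonal.run N s)).mem i j →
      j < P.election.n := by
  obtain ⟨-, h₁, h₂, h₃⟩ := mem_closure N (markDiagonal.run N s)
  have hedge : ∀ i j, MemEdge (markDiagonal.run N s).mem i j ↔ (i = j ∧ i < N) ∨
      ∃ (hi : i < P.election.n) (hj : j < P.election.n),
        ((⟨i, hi⟩, ⟨j, hj⟩) : Fin _ × Fin _) ∈ P.election.edges := by
    intro i j
    simp only [MemEdge, mem_markDiagonal, hs, inputMem, voterMem, voterBit]
    by_cases hi : i < P.election.n <;> by_cases hj : j < P.election.n <;> simp [hi, hj]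
  have sound : ∀ a b, Relation.TransGen (MemEdge (markDiagonal.run N s).mem) a b →
      ∀ ha : a < P.election.n, ∃ hb : b < P.election.n, P.election.Reaches ⟨a, ha⟩ ⟨b, hb⟩ := by
    intro a b hab ha
    have one : ∀ b c, MemEdge (markDiagonal.run N s).mem b c → ∀ hb : b < P.election.n,
        ∃ hc : c < P.election.n, P.election.Reaches ⟨b, hb⟩ ⟨c, hc⟩ := by
      intro b c hbc hb
      rcases (hedge b c).1 hbc with ⟨rfl, -⟩ | ⟨_, hc, he⟩
      exacts [⟨hb, .refl⟩, ⟨hc, .single he⟩]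
    induction hab with
    | single h => exact one _ _ h ha
    | tail _ h ih =>
      obtain ⟨hb, hr⟩ := ih
      obtain ⟨hc, hr'⟩ := one _ _ h hb
      exact ⟨hc, hr.trans hr'⟩
  refine ⟨fun i j => ⟨fun h => ?_, fun h => ?_⟩, fun i j h => (sound _ _ (h₂ _ _ h) i.2).1⟩
  · obtain ⟨_, hr⟩ := sound _ _ (h₂ _ _ h) i.2
    exact hr
  · induction h with
    | refl => exact h₁ _ _ ((hedge _ _).2 (.inl ⟨rfl, i.2.trans hN⟩))
    | @tail b c _ he ih =>
      exact h₃ b (b.2.trans hN) i (i.2.trans hN) c (c.2.trans hN) ih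
        (h₁ _ _ ((hedge _ _).2 (.inr ⟨b.2, c.2, he⟩)))

theorem ok_decisionProgram (P : DelegateReachabilityInstance) :
    (decisionProgram.run ((encode P).length + 1) (State.init initReg (encode P))).reg.ok = true ↔
      P.IsYes := by
  obtain ⟨hm₁, hz₁⟩ := mem_parse P initReg rfl
  have hv := memValue_vote P
  have hd := memValue_dele P
  have hb := memValue_bud P
  have hn : P.election.n < (encode P).length + 1 := Nat.lt_succ_of_le (n_le_length P)
  have h0 := fun i hi f hf => memValue_of_le P ((encode P).length + 1) (i := i) hi (f := f) hf
  simp only [decisionProgram, run_seq]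
  generalize (encode P).length + 1 = N at *
  generalize parse.run N (State.init initReg (encode P)) = s₁ at *
  have hE := memEdge_closure P hn s₁ hm₁
  set I := P.election with hI
  have hm₂ := mem_markDiagonal N s₁
  have hz₂ : (markDiagonal.run N s₁).idx .z = 0 :=
    (Keeps.idx_run (by simp [markDiagonal, Keeps, wr]) _).trans hz₁
  generalize markDiagonal.run N s₁ = s₂ at *
  have hm₃ := (mem_closure N s₂).1
  have hz₃ : (closure.run N s₂).idx .z = 0 :=
    (Keeps.idx_run (by simp [closure, Keeps, rd, wr]) _).trans hz₂
  generalize closure.run N s₂ = s₃ at *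
  obtain ⟨hm₄, hs₄⟩ := mem_subtract (N := N) s₃ hz₃
  have hz₄ : (subtract.run N s₃).idx .z = 0 :=
    (Keeps.idx_run (by simp [subtract, Keeps, rd, wr, op]) _).trans hz₃
  generalize subtract.run N s₃ = s₄ at *
  have hin : ∀ i j f, f ≠ Field.edge → f ≠ Field.diag → s₃.mem i j f = inputMem P i j f := by
    intro i j f h h'
    rw [hm₃ i j f h, hm₂, hm₁]
    simp [h, h']
  have hdiag : ∀ i < N, ∀ j < N, s₄.mem i j .diag = decide (i = j) := by
    intro i hi j hj
    rw [hm₄ _ _ _ (by simp) (by simp), hm₃ _ _ _ (by simp), hm₂, hm₁]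
    simp [inputMem, voterMem, voterBit, hi]
  obtain ⟨hm₅, hs₅⟩ := mem_choose s₄ hz₄ hdiag
  have hz₅ : (choose.run N s₄).idx .z = 0 :=
    (Keeps.idx_run (by simp [choose, Keeps, rd, wr]) _).trans hz₄
  generalize choose.run N s₄ = s₅ at *
  have hin₅ : ∀ i j f, f ∈ [Field.vote, Field.dele, Field.bud] →
      s₅.mem i j f = inputMem P i j f := by
    intro i j f h
    have h1 : f ≠ .cast ∧ f ≠ .diff ∧ f ≠ .pref ∧ f ≠ .edge ∧ f ≠ .diag := by
      simp at h
      rcases h with rfl | rfl | rfl <;> simp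
    rw [hm₅ _ _ _ h1.1, hm₄ _ _ _ h1.2.1 h1.2.2.1, hin _ _ _ h1.2.2.2.1 h1.2.2.2.2]
  have hpref : ∀ i : Fin I.n, s₄.mem i 0 .pref = true ↔ I.PrefersCasting i := by
    intro i
    rw [(hs₄ i (i.2.trans hn)).1, memValue_congr (fun b => hin _ _ _ (by simp) (by simp)),
      memValue_congr (fun b => hin _ _ _ (by simp) (by simp)), hv, hd]
    simp [CLDElection.PrefersCasting]
  have hdiff : ∀ i : Fin I.n, ¬ I.PrefersCasting i →
      memValue N s₄.mem .diff i = I.extraCost i := by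
    intro i hi
    have := (hs₄ i (i.2.trans hn)).2
    rw [memValue_congr (fun b => hin _ _ .dele (by simp) (by simp)),
      memValue_congr (fun b => hin _ _ .vote (by simp) (by simp)), hv, hd] at this
    simp only [CLDElection.PrefersCasting, not_lt] at hi
    have := this hi
    unfold CLDElection.extraCost
    lia
  have hex : ∀ i : Fin I.n, s₄.mem i 0 .ex = true := by
    intro i
    rw [hm₄ _ _ _ (by simp) (by simp), hin _ _ _ (by simp) (by simp)]
    simp [inputMem, voterMem, voterBit, ← hI]
  have hedge : ∀ i j, MemEdge s₄.mem i j ↔ MemEdge s₃.mem i j := fun i j => by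
    rw [MemEdge, MemEdge, hm₄ _ _ _ (by simp) (by simp)]
  have hcast : ∀ i : Fin I.n, s₅.mem i 0 .cast = true ↔ i ∈ I.greedySet := by
    intro i
    rw [hs₅ i (i.2.trans hn), hpref, CLDElection.mem_greedySet]
    refine or_congr_right ?_
    have hp : ∀ j : Fin I.n, s₄.mem j 0 .pref = false ↔ ¬ I.PrefersCasting j := fun j => by
      rw [← hpref, Bool.not_eq_true]
    rw [hp]
    simp only [hex, true_and, CLDElection.IsSoleCaster]
    refine and_congr_right fun hi => ?_
    constructor
    · intro h j hji hij
      rcases h j (j.2.trans hn) with h | h | ⟨h₁, h₂, h₃⟩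
      · exact absurd (Fin.ext h).symm hji
      · exact absurd ((hedge _ _).2 ((hE.1 i j).2 hij)) h
      · rw [hp] at h₂
        rw [hdiff i hi, hdiff j h₂, not_lt] at h₃
        exact ⟨(hE.1 j i).1 ((hedge _ _).1 h₁), h₂, h₃⟩
    -- The program also compares `i` with rows that belong to no voter; these are unreachable from
    -- `i`, so `i` prevails trivially.
    · intro h j hj
      by_cases hij : MemEdge s₃.mem i j
      · have hjn := hE.2 i j hij
        by_cases hji : (⟨j, hjn⟩ : Fin I.n) = i
        · exact .inl (by rw [← hji])
        · obtain ⟨h₁, h₂, h₃⟩ := h ⟨j, hjn⟩ hji ((hE.1 i ⟨j, hjn⟩).1 hij)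
          refine .inr (.inr ⟨(hedge _ _).2 ((hE.1 ⟨j, hjn⟩ i).2 h₁), (hp ⟨j, hjn⟩).2 h₂, ?_⟩)
          rw [not_lt, hdiff i hi, hdiff ⟨j, hjn⟩ h₂]
          exact h₃
      · exact .inr (.inl fun h => hij ((hedge _ _).1 h))
  rw [ok_spend s₅ hz₅, P.isYes_iff, CLDElection.cost_eq_sum,
    memValue_congr (fun b => hin₅ _ _ .bud (by simp)), hb]
  -- Rows beyond the voters hold zero costs, so summing over all `N` rows adds nothing.
  have hcost : ∑ i ∈ Finset.range N, memCost N s₅.mem i = ∑ i, I.voterCost I.greedySet i := by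
    rw [← Finset.sum_subset (Finset.range_mono hn.le), Finset.sum_range]
    · refine Finset.sum_congr rfl fun i _ => ?_
      rw [memCost, CLDElection.voterCost, memValue_congr (fun b => hin₅ _ _ .vote (by simp)),
        memValue_congr (fun b => hin₅ _ _ .dele (by simp)), hv, hd]
      simp only [hcast]
    · intro i _ hi
      have hi' : I.n ≤ i := by simpa using hi
      rw [memCost, memValue_congr (fun b => hin₅ _ _ .vote (by simp)),
        memValue_congr (fun b => hin₅ _ _ .dele (by simp)), h0 i hi' _ (by simp),
        h0 i hi' _ (by simp)]
      simp
  rw [hcost]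

end DelegateReachability

theorem theorem1 :
    SolvableInPolyTime DelegateReachabilityInstance.encode DelegateReachabilityInstance.IsYes ∧
    ∀ I : CLDElection,
      (∃ C, I.IsGreedy C) ∧
      ∀ C, I.IsGreedy C →
        (∃ D, I.IsSolution C D ∧ I.ReachesCasters C D) ∧
        ∀ C' D', I.IsSolution C' D' → I.ReachesCasters C' D' → I.cost C ≤ I.cost C' := by
  -- The decision function is the `ok` bit after the run; unification reads it off the correctness
  -- lemma.
  refine ⟨⟨_, DelegateReachability.ok_decisionProgram, ?_⟩, fun I => ⟨⟨_, I.isGreedy_greedySet⟩,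
    fun C hC => ⟨CLDElection.exists_solution_of_reaches hC.exists_reaches, fun C' D' hs hr =>
      hC.cost_le (CLDElection.exists_reaches_of_solution hs hr)⟩⟩⟩
  -- Only the initial content of the symbol buffer depends on this choice; any symbol would do.
  have : Inhabited Computability.Γ' := ⟨.blank⟩
  exact StackProgram.nonempty_computableInPolyTime _
    DelegateReachability.wellFormed_decisionProgram .z DelegateReachability.initReg (·.ok)
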